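/- Let $G$ be a simple graph with $n$ vertices, let $L(G)=D(G)-A(G)$ be its Laplacian matrix, and define its Laplacian coefficients $c_0(G),\dots,c_n(G)$ by $\det(xI_n-L(G))=\sum_{k=0}^{n}(-1)^k c_k(G)\,x^{n-k}$. For graphs $G,H$ with $n$ vertices write $G\preceq H$ if $c_k(G)\le c_k(H)$ for all $0\le k\le n$, and $G\prec H$ if $G\preceq H$ and $c_k(G)<c_k(H)$ for some $k\in\{0,\dots,n\}$. Let $\mathcal U_{n,l}^{g}$ be the set of unicyclic graphs (connected graphs with as many edges as vertices) with $n$ vertices, $l$ leaves (vertices of degree $1$) and girth $g$. For trees $T_1,\dots,T_g$ with chosen roots, let $C_{T_1,\dots,T_g}$ be the graph obtained from a cycle $u_1u_2\cdots u_g$ by attaching $T_i$ with its root at $u_i$ for each $i$ (that is, the root of $T_i$ is identified with $u_i$). Let $\mathcal U_{n,l}^{g,2}$ be the set of those graphs of the form $C_{T_1,\dots,T_g}$ in $\mathcal U_{n,l}^{g}$ for which exactly two of the trees $T_1,\dots,T_g$ have more than one vertex. Let $BST_{N,l}$ be the balanced starlike tree of order $N$ with $l$ leaves, obtained from $l$ paths,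 each with $\lfloor\frac{N-1}{l}\rfloor+1$ or $\lceil\frac{N-1}{l}\rceil+1$ vertices, by identifying one end of each of them to a single vertex, the center. Let $U^0=U_{n,l}^{g,0}$ be the graph of order $n$ obtained by identifying a vertex of a cycle of order $g$ with the center of $BST_{n-g+1,l}$. **Theorem.** For every $G\in\mathcal U_{n,l}^{g,2}$ we have $U^0\prec G$. -/

import Mathlib

namespace LapUnicyclic

/-- The Laplacian coefficient `c_k(G)` of a graph of order `n`, where
`det (x I - L(G)) = ∑_{k=0}^{n} (-1)^k c_k(G) x^{n-k}` (meaningful for `k ≤ n`). -/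
noncomputable def lapCoeff {V : Type*} [Fintype V] (G : SimpleGraph V) (k : ℕ) : ℝ :=
  open Classical in (-1) ^ k * (G.lapMatrix ℝ).charpoly.coeff (Fintype.card V - k)

/-- `G ⪯ H`: the two graphs have the same order `n` and `c_k(G) ≤ c_k(H)` for all `0 ≤ k ≤ n`. -/
def LapLE {V W : Type*} [Fintype V] [Fintype W] (G : SimpleGraph V) (H : SimpleGraph W) : Prop :=
  Fintype.card V = Fintype.card W ∧ ∀ k ≤ Fintype.card V, lapCoeff G k ≤ lapCoeff H k

/-- `G ≺ H`: `G ⪯ H` and `c_k(G) < c_k(H)` for some `0 ≤ k ≤ n`. -/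
def LapLT {V W : Type*} [Fintype V] [Fintype W] (G : SimpleGraph V) (H : SimpleGraph W) : Prop :=
  LapLE G H ∧ ∃ k ≤ Fintype.card V, lapCoeff G k < lapCoeff H k

/-- A finite graph is unicyclic if it is connected and has as many edges as vertices. -/
def IsUnicyclic {V : Type*} [Fintype V] (G : SimpleGraph V) : Prop :=
  G.Connected ∧ G.edgeSet.ncard = Fintype.card V

/-- The number of leaves (vertices of degree one). -/
noncomputable def numLeaves {V : Type*} [Fintype V] (G : SimpleGraph V) : ℕ :=
  open Classical in (Finset.univ.filter fun v => G.degree v = 1).card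

/-- `G` belongs to `𝓤_{n,l}^g`: it is a unicyclic graph with `n` vertices, `l` leaves
and girth `g`. -/
def IsInU (n l g : ℕ) {V : Type*} [Fintype V] (G : SimpleGraph V) : Prop :=
  IsUnicyclic G ∧ Fintype.card V = n ∧ numLeaves G = l ∧ G.egirth = (g : ℕ∞)

/-- The graph `C_{T_1,…,T_g}`: on the disjoint union of the vertex sets of the graphs `T i`,
keep all edges of every `T i` and join the roots `r i` in a cycle of order `g`. -/
def attachTrees {g : ℕ} {W : Fin g → Type*} (T : ∀ i, SimpleGraph (W i)) (r : ∀ i, W i) :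
    SimpleGraph (Σ i, W i) :=
  (SimpleGraph.cycleGraph g).map (fun i => ⟨i, r i⟩) ⊔ ⨆ i, (T i).map (Sigma.mk i)

/-- `G` belongs to `𝓤_{n,l}^{g,2}`: it is a graph of `𝓤_{n,l}^g` of the form `C_{T_1,…,T_g}`
in which exactly two of the rooted trees `T_i` have more than one vertex. -/
def IsInU2 (n l g : ℕ) {V : Type*} [Fintype V] (G : SimpleGraph V) : Prop :=
  IsInU n l g G ∧
    ∃ (W : Fin g → Type) (_ : ∀ i, Fintype (W i)) (T : ∀ i, SimpleGraph (W i)) (r : ∀ i, W i),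
      (∀ i, (T i).IsTree) ∧
      (∃ i j : Fin g, i ≠ j ∧ 1 < Fintype.card (W i) ∧ 1 < Fintype.card (W j) ∧
        ∀ m, m ≠ i → m ≠ j → Fintype.card (W m) = 1) ∧
      Nonempty (G ≃g attachTrees T r)

/-- The inclusion into the starlike tree of its `i`-th leg, a path with `m i + 1` vertices
whose first vertex is the center `none`. -/
def legMap {l : ℕ} (m : Fin l → ℕ) (i : Fin l) : Fin (m i + 1) → Option (Σ i, Fin (m i)) :=
  Fin.cases none fun j => some ⟨i, j⟩

/-- The starlike tree obtained from `l` paths of orders `m i + 1` by identifying one end of each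
of them; the common end, the center, is `none`. -/
def starlike {l : ℕ} (m : Fin l → ℕ) : SimpleGraph (Option (Σ i, Fin (m i))) :=
  ⨆ i, (SimpleGraph.pathGraph (m i + 1)).map (legMap m i)

/-- The leg lengths of the balanced starlike tree `BST_{N,l}`: each of the numbers
`⌊(N - 1 + i) / l⌋`, `0 ≤ i < l`, is `⌊(N - 1) / l⌋` or `⌈(N - 1) / l⌉`, and for `l ≥ 1` their sum
is `N - 1`. -/
def legLength (N l : ℕ) (i : Fin l) : ℕ := (N - 1 + i) / l

/-- The vertices of `BST_{N,l}`; the center is `none`. -/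
abbrev BSTVertex (N l : ℕ) : Type := Option (Σ i : Fin l, Fin (legLength N l i))

/-- The balanced starlike tree `BST_{N,l}` of order `N` with `l` leaves. -/
def BST (N l : ℕ) : SimpleGraph (BSTVertex N l) := starlike (legLength N l)

/-- The inclusion of the second graph into the graph obtained by identifying its vertex `b` with
the vertex `a` of the first graph. -/
def glueMap {V W : Type*} [DecidableEq W] (a : V) (b : W) (w : W) : V ⊕ {w : W // w ≠ b} :=
  if h : w = b then Sum.inl a else Sum.inr ⟨w, h⟩

/-- The graph obtained from disjoint graphs `G` and `H` by identifying the vertex `a` of `G` with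
the vertex `b` of `H`. -/
def glue {V W : Type*} [DecidableEq W] (G : SimpleGraph V) (a : V) (H : SimpleGraph W) (b : W) :
    SimpleGraph (V ⊕ {w : W // w ≠ b}) :=
  G.map Sum.inl ⊔ H.map (glueMap a b)

/-- The graph `U⁰ = U_{n,l}^{g,0}`: the vertex `u` of a cycle of order `g` is identified with the
center of the balanced starlike tree `BST_{n-g+1,l}`. -/
def U0 (n l g : ℕ) (u : Fin g) :
    SimpleGraph (Fin g ⊕ {w : BSTVertex (n - g + 1) l // w ≠ none}) :=
  glue (SimpleGraph.cycleGraph g) u (BST (n - g + 1) l) none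

end LapUnicyclic

/-! Up to alternating signs the Laplacian coefficients are the coefficients of `det (X I + L)`, so
the claim is a coefficientwise inequality between two such determinants. An attached rooted tree
influences the determinant only through its root minor `a` and the remainder `b = det - X a`
(`det_blockDiagonal_add`). Written as a dual number `a + b ε`, this datum is multiplied when trees
are glued at their roots and is transformed linearly by `grow` when the root is prolonged by an edge
(`rootPair_joinEdge`). All the polynomials involved have nonnegative coefficients because the
Laplacian is positive semidefinite (`CoeffNonneg.det_add_diagonal`).

Let the cycle have determinant `D`, vertex minor `m` (the same at every vertex) and let `m'` be its
minor with two given vertices deleted. With trees `(a, b)` and `(a', b')` at these two vertices the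
determinant is `a a' D + (a b' + b a') m + b b' m'` (`det_mul_diagonal_add_single`). The first two
terms are what both trees would give at a single vertex; the last one is nonzero with nonnegative
coefficients, and it provides strictness.

It remains to replace the tree glued from both, whose root has degree at least two, by the balanced
starlike tree. Since `D` is `X m` plus a polynomial with nonnegative coefficients, it is enough to
compare `phi = X a + b` and `a`, which is the relation `Dom`. The comparison `RTree.compare_spider`
goes by induction on the number of edges and uses two moves: merging two branching vertices joined
by a path (`phi_two_centers`) and equalising leg lengths (`dom_balanced`). Both moves rest on the
ratio `b / a` of a path growing with its length (`leg_mono`). -/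

namespace LapUnicyclic
open Polynomial

/-! ### Polynomials with nonnegative coefficients. -/

/-- A real polynomial all of whose coefficients are nonnegative. -/
def CoeffNonneg (p : ℝ[X]) : Prop := ∀ k, 0 ≤ p.coeff k

namespace CoeffNonneg

theorem zero : CoeffNonneg 0 := fun k => by simp

theorem one : CoeffNonneg 1 := fun k => by
  rw [coeff_one]; split_ifs <;> norm_num

theorem X : CoeffNonneg X := fun k => by
  rw [coeff_X]; split_ifs <;> norm_num

theorem C {c : ℝ} (hc : 0 ≤ c) : CoeffNonneg (C c) := fun k => by
  rw [coeff_C]; split_ifs <;> simp [hc]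

theorem add {p q : ℝ[X]} (hp : CoeffNonneg p) (hq : CoeffNonneg q) : CoeffNonneg (p + q) :=
  fun k => by rw [coeff_add]; exact add_nonneg (hp k) (hq k)

theorem mul {p q : ℝ[X]} (hp : CoeffNonneg p) (hq : CoeffNonneg q) : CoeffNonneg (p * q) :=
  fun k => by
    rw [coeff_mul]
    exact Finset.sum_nonneg fun x _ => mul_nonneg (hp _) (hq _)

theorem eval_one_nonneg {p : ℝ[X]} (hp : CoeffNonneg p) : 0 ≤ p.eval 1 := by
  rw [eval_eq_sum_range]
  exact Finset.sum_nonneg fun i _ => by simpa using hp i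

theorem exists_coeff_pos {p : ℝ[X]} (hp : CoeffNonneg p) (h : p ≠ 0) : ∃ k, 0 < p.coeff k := by
  by_contra! hk
  exact h (Polynomial.ext fun k => by simpa using le_antisymm (hk k) (hp k))

end CoeffNonneg

/-! ### Rooted trees as dual numbers, and their partial order. -/

/-- The pair `(a, b)`, written `a + b ε`, of a rooted tree `(T, r)`: with `M = X I + L(T)`, `a` is
the principal minor of `M` at `r` and `b = det M - X a`. Gluing trees at their roots
multiplies the pairs. -/
abbrev RootPair : Type := DualNumber ℝ[X]

namespace RootPair

open TrivSqZeroExt (fst snd)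

/-- The polynomial `det (X I + L(T))` recovered from the pair of a rooted tree. -/
noncomputable def phi (p : RootPair) : ℝ[X] := X * p.fst + p.snd

/-- The pair obtained by joining the root by an edge to a new vertex, the new root. -/
noncomputable def grow (p : RootPair) : RootPair :=
  (((X + 1) * p.fst + p.snd, X * p.fst + p.snd) : ℝ[X] × ℝ[X])

@[simp] theorem fst_grow (p : RootPair) : (grow p).fst = (X + 1) * p.fst + p.snd := rfl

@[simp] theorem snd_grow (p : RootPair) : (grow p).snd = X * p.fst + p.snd := rfl

@[simp] theorem mul_fst (p q : RootPair) : (p * q).fst = p.fst * q.fst := rfl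

@[simp] theorem mul_snd (p q : RootPair) : (p * q).snd = p.fst * q.snd + p.snd * q.fst := by
  simp [TrivSqZeroExt.snd_mul, mul_comm]

/-- Both components have nonnegative coefficients. -/
def Good (p : RootPair) : Prop := CoeffNonneg p.fst ∧ CoeffNonneg p.snd

theorem good_one : Good 1 := ⟨CoeffNonneg.one, CoeffNonneg.zero⟩

theorem Good.mul {p q : RootPair} (hp : Good p) (hq : Good q) : Good (p * q) := by
  refine ⟨?_, ?_⟩
  · rw [mul_fst]; exact hp.1.mul hq.1
  · rw [mul_snd]; exact (hp.1.mul hq.2).add (hp.2.mul hq.1)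

theorem Good.grow {p : RootPair} (hp : Good p) : Good (grow p) :=
  ⟨((CoeffNonneg.X.add CoeffNonneg.one).mul hp.1).add hp.2, (CoeffNonneg.X.mul hp.1).add hp.2⟩

/-- Coefficientwise domination of both `phi` and the root minor. -/
def Dom (x y : RootPair) : Prop :=
  CoeffNonneg (phi x - phi y) ∧ CoeffNonneg (x.fst - y.fst)

theorem Dom.refl (x : RootPair) : Dom x x := by
  simp [Dom, CoeffNonneg.zero]

theorem Dom.trans {x y z : RootPair} (h : Dom x y) (h' : Dom y z) : Dom x z := by
  refine ⟨?_, ?_⟩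
  · simpa using h.1.add h'.1
  · simpa using h.2.add h'.2

theorem Dom.mul_left {x y : RootPair} (z : RootPair) (hz : Good z) (h : Dom x y) :
    Dom (z * x) (z * y) := by
  refine ⟨?_, ?_⟩
  · have : phi (z * x) - phi (z * y) = z.fst * (phi x - phi y) + z.snd * (x.fst - y.fst) := by
      simp only [phi, mul_fst, mul_snd]; ring
    rw [this]
    exact (hz.1.mul h.1).add (hz.2.mul h.2)
  · have : (z * x).fst - (z * y).fst = z.fst * (x.fst - y.fst) := by
      simp only [mul_fst]; ring
    rw [this]
    exact hz.1.mul h.2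

/-- In the coordinates `phi` and `fst` the map `grow` has nonnegative coefficients. This is why
`Dom` compares these two and not `fst` and `snd`. -/
theorem Dom.grow {x y : RootPair} (h : Dom x y) : Dom (grow x) (grow y) := by
  refine ⟨?_, ?_⟩
  · have : phi (RootPair.grow x) - phi (RootPair.grow y) =
        X * (phi x - phi y) + X * (x.fst - y.fst) + (phi x - phi y) := by
      simp only [phi, fst_grow, snd_grow]; ring
    rw [this]
    exact ((CoeffNonneg.X.mul h.1).add (CoeffNonneg.X.mul h.2)).add h.1
  · have : (RootPair.grow x).fst - (RootPair.grow y).fst =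
        (phi x - phi y) + (x.fst - y.fst) := by
      simp only [phi, fst_grow]; ring
    rw [this]
    exact h.1.add h.2

theorem Good.grow_iterate {p : RootPair} (hp : Good p) (k : ℕ) : Good (RootPair.grow^[k] p) := by
  induction k with
  | zero => exact hp
  | succ k ih => rw [Function.iterate_succ_apply']; exact ih.grow

theorem Dom.grow_iterate {x y : RootPair} (h : Dom x y) (k : ℕ) :
    Dom (RootPair.grow^[k] x) (RootPair.grow^[k] y) := by
  induction k with
  | zero => exact h
  | succ k ih => rw [Function.iterate_succ_apply', Function.iterate_succ_apply']; exact ih.grow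

/-- Both sides belong to the tree in which the two roots are joined by an edge, rooted at one end or
the other; `phi` does not see the root. -/
theorem phi_mul_grow (x y : RootPair) : phi (x * grow y) = phi (grow x * y) := by
  simp only [phi, mul_fst, mul_snd, fst_grow, snd_grow]; ring

theorem phi_mul_grow_iterate (x y : RootPair) (k : ℕ) :
    phi (x * grow^[k] y) = phi (grow^[k] x * y) := by
  induction k generalizing x with
  | zero => rfl
  | succ k ih =>
    rw [Function.iterate_succ_apply', phi_mul_grow, ih, Function.iterate_succ_apply]

/-- The matrix of the `k`-th iterate of `grow`. -/
theorem exists_grow_iterate (k : ℕ) : ∃ A B : ℝ[X], CoeffNonneg A ∧ CoeffNonneg B ∧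
    ∀ w : RootPair, (grow^[k] w).fst = A * w.fst + B * w.snd ∧
      (grow^[k] w).snd = X * B * w.fst + (A - X * B) * w.snd := by
  induction k with
  | zero => exact ⟨1, 0, CoeffNonneg.one, CoeffNonneg.zero, fun w => by simp⟩
  | succ k ih =>
    obtain ⟨A, B, hA, hB, h⟩ := ih
    -- The new `B` is `(X + 1) * B + (A - X * B)`, so the subtraction in the second row cancels and
    -- nonnegativity survives.
    refine ⟨(X + 1) * A + X * B, A + B, ((CoeffNonneg.X.add CoeffNonneg.one).mul hA).add
      (CoeffNonneg.X.mul hB), hA.add hB, fun w => ?_⟩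
    rw [Function.iterate_succ_apply', fst_grow, snd_grow, (h w).1, (h w).2]
    constructor <;> ring

/-- The pair of a path with `m + 1` vertices, rooted at an end. -/
noncomputable def leg (m : ℕ) : RootPair := grow^[m] 1

@[simp] theorem leg_zero : leg 0 = 1 := rfl

theorem leg_succ (m : ℕ) : leg (m + 1) = grow (leg m) := Function.iterate_succ_apply' _ _ _

theorem grow_iterate_leg (k m : ℕ) : grow^[k] (leg m) = leg (m + k) := by
  rw [leg, ← Function.iterate_add_apply, add_comm]; rfl

theorem good_leg (m : ℕ) : Good (leg m) := good_one.grow_iterate m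

/-- The quadratic form is the 2 × 2 determinant of `w` and `grow w`. It is invariant because `grow`
has determinant one, and at the one-vertex tree `(1, 0)` it equals `X`. -/
theorem leg_quadratic (m : ℕ) : X * (leg m).fst ^ 2 - X * (leg m).fst * (leg m).snd -
    (leg m).snd ^ 2 = X := by
  induction m with
  | zero => simp
  | succ m ih =>
    rw [leg_succ, fst_grow, snd_grow]
    linear_combination ih

/-- This is the cross-multiplied form of `snd / fst` increasing with the length. By
`exists_grow_iterate` the difference is `B` times the invariant form of `leg_quadratic`. -/
theorem leg_mono {p q : ℕ} (h : p ≤ q) :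
    CoeffNonneg ((leg q).snd * (leg p).fst - (leg p).snd * (leg q).fst) := by
  obtain ⟨k, rfl⟩ := Nat.exists_eq_add_of_le h
  obtain ⟨A, B, -, hB, hAB⟩ := exists_grow_iterate k
  rw [← grow_iterate_leg, (hAB _).1, (hAB _).2]
  have : (X * B * (leg p).fst + (A - X * B) * (leg p).snd) * (leg p).fst -
      (leg p).snd * (A * (leg p).fst + B * (leg p).snd) = B * X := by
    linear_combination B * leg_quadratic p
  rw [this]
  exact hB.mul CoeffNonneg.X

/-- Shifting one vertex from a longer leg to a shorter one decreases the pair. -/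
theorem dom_leg_mul_leg {p q : ℕ} (h : q ≤ p) :
    Dom (leg (p + 1) * leg q) (leg p * leg (q + 1)) := by
  rw [leg_succ, leg_succ]
  refine ⟨?_, ?_⟩
  · rw [phi_mul_grow, sub_self]; exact CoeffNonneg.zero
  · have : (grow (leg p) * leg q).fst - (leg p * grow (leg q)).fst =
        (leg p).snd * (leg q).fst - (leg q).snd * (leg p).fst := by
      simp only [mul_fst, fst_grow]; ring
    rw [this]
    exact leg_mono h

/-- Moving the tree `y` along a path with `k` edges from the root of `x` to the root of `z`. -/
theorem phi_mul_grow_iterate_sub {x y z : RootPair} (hy : Good y) (k : ℕ)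
    (h : CoeffNonneg (z.snd * x.fst - x.snd * z.fst)) :
    CoeffNonneg (phi (z * grow^[k] (x * y)) - phi (z * y * grow^[k] x)) := by
  obtain ⟨A, B, -, hB, hAB⟩ := exists_grow_iterate k
  have : phi (z * grow^[k] (x * y)) - phi (z * y * grow^[k] x) =
      y.snd * (B * (z.snd * x.fst - x.snd * z.fst)) := by
    simp only [phi, mul_fst, mul_snd, (hAB _).1, (hAB _).2]; ring
  rw [this]
  exact hy.2.mul (hB.mul h)

/-- Sliding the tree `y` from the far end of a path to the root lowers the root minor, here without
any condition on ratios. -/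
theorem fst_grow_iterate_mul_sub {x y : RootPair} (hx : Good x) (hy : Good y) (k : ℕ) :
    CoeffNonneg ((grow^[k] (x * y)).fst - (grow^[k] x * y).fst) := by
  obtain ⟨A, B, -, hB, hAB⟩ := exists_grow_iterate k
  have : (grow^[k] (x * y)).fst - (grow^[k] x * y).fst = B * x.fst * y.snd := by
    simp only [mul_fst, mul_snd, (hAB _).1]; ring
  rw [this]
  exact (hB.mul hx.1).mul hy.2

/-! ### Starlike trees and balancing of legs. -/

/-- The pair of a starlike tree rooted at its center, from the multiset of its leg lengths. -/
noncomputable def spider (m : Multiset ℕ) : RootPair := (m.map leg).prod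

@[simp] theorem spider_zero : spider 0 = 1 := by simp [spider]

@[simp] theorem spider_cons (p : ℕ) (m : Multiset ℕ) : spider (p ::ₘ m) = leg p * spider m := by
  simp [spider]

theorem spider_add (m m' : Multiset ℕ) : spider (m + m') = spider m * spider m' := by
  simp [spider]

theorem good_spider (m : Multiset ℕ) : Good (spider m) := by
  induction m using Multiset.induction with
  | empty => simpa using good_one
  | cons p m ih => rw [spider_cons]; exact (good_leg p).mul ih

/-- The leg lengths of a balanced starlike tree with `e` edges and `l` legs. -/
def balanced (e l : ℕ) : Multiset ℕ := (Multiset.range l).map fun i => (e + i) / l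

@[simp] theorem card_balanced (e l : ℕ) : (balanced e l).card = l := by simp [balanced]

/-- A form of Hermite's identity: raising `e` by one shifts the window and trades the term `e / l`
for `(e + l) / l = e / l + 1`. -/
theorem sum_div_eq (e : ℕ) {l : ℕ} (hl : 0 < l) : ∑ i ∈ Finset.range l, (e + i) / l = e := by
  induction e with
  | zero =>
    refine Finset.sum_eq_zero fun i hi => ?_
    rw [zero_add]
    exact Nat.div_eq_of_lt (Finset.mem_range.1 hi)
  | succ e ih =>
    have h1 := Finset.sum_range_succ (fun i => (e + i) / l) l
    have h2 := Finset.sum_range_succ' (fun i => (e + i) / l) l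
    have h3 : (e + l) / l = e / l + 1 := Nat.add_div_right e hl
    have h4 : ∑ i ∈ Finset.range l, (e + 1 + i) / l = ∑ i ∈ Finset.range l, (e + (i + 1)) / l :=
      Finset.sum_congr rfl fun i _ => by congr 1; ring
    simp only [add_zero] at h2
    omega

theorem sum_balanced (e : ℕ) {l : ℕ} (hl : 0 < l) : (balanced e l).sum = e :=
  sum_div_eq e hl

/-- A multiset of almost equal numbers is determined by its cardinality and its sum. -/
theorem eq_balanced {m : Multiset ℕ} (h : ∀ a ∈ m, ∀ b ∈ m, a ≤ b + 1) :
    m = balanced m.sum m.card := by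
  -- Only the minimum `c` and `c + 1` occur, and division with remainder of the sum by the
  -- cardinality recovers `c` and the multiplicities. Both `m` and the balanced multiset have this
  -- normal form.
  have key : ∀ m : Multiset ℕ, (∀ a ∈ m, ∀ b ∈ m, a ≤ b + 1) → 0 < m.card →
      m = Multiset.replicate (m.card - m.sum % m.card) (m.sum / m.card) +
        Multiset.replicate (m.sum % m.card) (m.sum / m.card + 1) := by
    intro m h hm
    obtain ⟨c, hc, hmin⟩ : ∃ c ∈ m, ∀ b ∈ m, c ≤ b := by
      obtain ⟨d, hd⟩ := Multiset.card_pos_iff_exists_mem.1 hm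
      obtain ⟨c, hc, hmin⟩ := m.toFinset.exists_min_image id ⟨d, by simpa using hd⟩
      exact ⟨c, by simpa using hc, fun b hb => hmin b (by simpa using hb)⟩
    have hsplit : m = Multiset.replicate (m.count c) c +
        Multiset.replicate (m.count (c + 1)) (c + 1) := by
      ext x
      rw [Multiset.count_add, Multiset.count_replicate, Multiset.count_replicate]
      by_cases hx : x ∈ m
      · have h1 := hmin x hx
        have h2 := h x hx c hc
        obtain rfl | rfl : x = c ∨ x = c + 1 := by omega
        · simp
        · simp
      · have hx1 : c ≠ x := by rintro rfl; exact hx hc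
        rw [if_neg hx1, Multiset.count_eq_zero_of_notMem hx]
        split_ifs with h3
        · rw [h3, Multiset.count_eq_zero_of_notMem hx]
        · rfl
    have hcard : m.card = m.count c + m.count (c + 1) := by
      conv_lhs => rw [hsplit]
      simp
    have hsum : m.sum = m.card * c + m.count (c + 1) := by
      conv_lhs => rw [hsplit]
      rw [hcard]
      simp
      ring
    have hpos : 0 < m.count c := Multiset.count_pos.2 hc
    have hlt : m.count (c + 1) < m.card := by omega
    have hdiv : m.sum / m.card = c := by
      rw [hsum, Nat.mul_add_div hm, Nat.div_eq_of_lt hlt, add_zero]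
    have hmod : m.sum % m.card = m.count (c + 1) := by
      rw [hsum, Nat.mul_add_mod, Nat.mod_eq_of_lt hlt]
    rw [hdiv, hmod, hcard, Nat.add_sub_cancel]
    exact hsplit
  obtain hm | hm := Nat.eq_zero_or_pos m.card
  · rw [hm]
    simpa [balanced] using hm
  · have hb := key (balanced m.sum m.card) (fun a ha b hb => by
      simp only [balanced, Multiset.mem_map, Multiset.mem_range] at ha hb
      obtain ⟨i, hi, rfl⟩ := ha
      obtain ⟨j, hj, rfl⟩ := hb
      rw [← Nat.add_div_right _ hm]
      exact Nat.div_le_div_right (by omega)) (by simpa using hm)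
    rw [card_balanced, sum_balanced _ hm] at hb
    exact (key m h hm).trans hb.symm

/-- Among starlike trees with given number of edges and legs the balanced one is minimal. -/
theorem dom_balanced (m : Multiset ℕ) : Dom (spider m) (spider (balanced m.sum m.card)) := by
  -- Moving one vertex from a leg to another that is shorter by at least two lowers the sum of
  -- squares.
  induction hN : (m.map fun a => a ^ 2).sum using Nat.strong_induction_on generalizing m with
  | _ N ih =>
  by_cases h : ∀ a ∈ m, ∀ b ∈ m, a ≤ b + 1
  · rw [← eq_balanced h]; exact Dom.refl _
  · push Not at h
    obtain ⟨a, ha, b, hb, hab⟩ := h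
    obtain ⟨m₁, rfl⟩ := Multiset.exists_cons_of_mem ha
    have hb' : b ∈ m₁ := by
      obtain h | h := Multiset.mem_cons.1 hb
      · omega
      · exact h
    obtain ⟨m₂, rfl⟩ := Multiset.exists_cons_of_mem hb'
    obtain ⟨p, rfl⟩ : ∃ p, a = p + 1 := ⟨a - 1, by omega⟩
    have h1 : Dom (spider ((p + 1) ::ₘ b ::ₘ m₂)) (spider (p ::ₘ (b + 1) ::ₘ m₂)) := by
      simp only [spider_cons, ← mul_assoc]
      rw [mul_comm _ (spider m₂), mul_comm _ (spider m₂)]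
      exact (dom_leg_mul_leg (by omega)).mul_left _ (good_spider m₂)
    refine h1.trans ?_
    have h2 := ih _ (by
      rw [← hN]
      simp only [Multiset.map_cons, Multiset.sum_cons]
      nlinarith) (p ::ₘ (b + 1) ::ₘ m₂) rfl
    convert h2 using 3
    · simp; ring
    · simp

theorem dom_balanced_of_eq {m : Multiset ℕ} {e l : ℕ} (he : m.sum = e) (hl : m.card = l) :
    Dom (spider m) (spider (balanced e l)) := by
  subst he hl
  exact dom_balanced m

/-- Two starlike trees whose centers are joined by a path have larger `phi` than the balanced
starlike tree. -/
theorem phi_two_centers {m₁ m₂ : Multiset ℕ} (h₁ : m₁ ≠ 0) (h₂ : m₂ ≠ 0) (k : ℕ) :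
    CoeffNonneg (phi (spider m₁ * grow^[k] (spider m₂)) -
      phi (spider (balanced (m₁.sum + m₂.sum + k) (m₁.card + m₂.card)))) := by
  obtain ⟨p, hp⟩ := Multiset.exists_mem_of_ne_zero h₁
  obtain ⟨q, hq⟩ := Multiset.exists_mem_of_ne_zero h₂
  -- The two centers play symmetric roles, since the connecting path may be grown from either end.
  wlog hqp : q ≤ p generalizing m₁ m₂ p q
  · have := this h₂ h₁ q hq p hp (by omega)
    rwa [mul_comm, ← phi_mul_grow_iterate, add_comm m₂.sum, add_comm m₂.card] at this
  obtain ⟨m₁, rfl⟩ := Multiset.exists_cons_of_mem hp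
  obtain ⟨m₂, rfl⟩ := Multiset.exists_cons_of_mem hq
  -- The first center carries a leg at least as long as `q`, so its ratio `snd / fst` exceeds that
  -- of `leg q`. Hence all legs `m₂` may slide to the first center, and the leg `q` with the path
  -- becomes one leg of length `q + k`.
  have hz : CoeffNonneg ((spider (p ::ₘ m₁)).snd * (leg q).fst -
      (leg q).snd * (spider (p ::ₘ m₁)).fst) := by
    have : (spider (p ::ₘ m₁)).snd * (leg q).fst - (leg q).snd * (spider (p ::ₘ m₁)).fst =
        ((leg p).snd * (leg q).fst - (leg q).snd * (leg p).fst) * (spider m₁).fst +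
        (leg p).fst * (spider m₁).snd * (leg q).fst := by
      simp only [spider_cons, mul_fst, mul_snd]; ring
    rw [this]
    exact ((leg_mono hqp).mul (good_spider m₁).1).add
      (((good_leg p).1.mul (good_spider m₁).2).mul (good_leg q).1)
  have h3 := phi_mul_grow_iterate_sub (good_spider m₂) k hz
  have h4 := (dom_balanced_of_eq (m := (q + k) ::ₘ ((p ::ₘ m₁) + m₂))
    (e := (p ::ₘ m₁).sum + (q ::ₘ m₂).sum + k) (l := (p ::ₘ m₁).card + (q ::ₘ m₂).card)
    (by simp; ring) (by simp; ring)).1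
  rw [spider_cons (q + k), spider_add, mul_comm, ← grow_iterate_leg] at h4
  rw [spider_cons q]
  simpa using h3.add h4

end RootPair
end LapUnicyclic

/-! ### Rooted plane trees and their comparison with balanced starlike trees. -/

namespace LapUnicyclic
open Polynomial

theorem CoeffNonneg.mul_sub_mul {p q p' q' : ℝ[X]} (hp : CoeffNonneg (p - p'))
    (hq : CoeffNonneg (q - q')) (hp' : CoeffNonneg p') (hq' : CoeffNonneg q) :
    CoeffNonneg (p * q - p' * q') := by
  have : p * q - p' * q' = (p - p') * q + p' * (q - q') := by ring
  rw [this]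
  exact (hp.mul hq').add (hp'.mul hq)

/-- Rooted plane trees: `nil` is a single vertex, and `node c r` is obtained from `r` by joining
its root to the root of `c`. -/
inductive RTree : Type
  | nil : RTree
  | node (c r : RTree) : RTree

namespace RTree

open RootPair

/-- The number of edges. -/
def edges : RTree → ℕ
  | nil => 0
  | node c r => edges c + 1 + edges r

/-- The number of vertices other than the root that have degree one. -/
def leaves : RTree → ℕ
  | nil => 0
  | node nil r => 1 + leaves r
  | node (node a b) r => leaves (node a b) + leaves r

/-- The degree of the root. -/
def rootDegree : RTree → ℕ
  | nil => 0
  | node _ r => rootDegree r + 1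

/-- The pair of a rooted tree. -/
noncomputable def val : RTree → RootPair
  | nil => 1
  | node c r => grow (val c) * val r

/-- The tree obtained by identifying the roots of two trees. -/
def append : RTree → RTree → RTree
  | nil, s => s
  | node c r, s => node c (append r s)

theorem edges_append (t s : RTree) : (append t s).edges = t.edges + s.edges := by
  induction t with
  | nil => simp [append, edges]
  | node c r _ ih => simp [append, edges, ih]; ring

theorem leaves_node (c r : RTree) : (node c r).leaves = (node c nil).leaves + r.leaves := by
  cases c <;> simp [leaves]

theorem leaves_append (t s : RTree) : (append t s).leaves = t.leaves + s.leaves := by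
  induction t with
  | nil => simp [append, leaves]
  | node c r _ ih => rw [append, leaves_node, ih, leaves_node c r, add_assoc]

theorem val_append (t s : RTree) : (append t s).val = t.val * s.val := by
  induction t with
  | nil => simp [append, val]
  | node c r _ ih => simp only [append, val, ih, mul_assoc]

theorem rootDegree_append (t s : RTree) :
    (append t s).rootDegree = t.rootDegree + s.rootDegree := by
  induction t with
  | nil => simp [append, rootDegree]
  | node c r _ ih => simp only [append, rootDegree, ih]; ring

theorem rootDegree_pos {t : RTree} (ht : t ≠ nil) : 0 < t.rootDegree := by
  cases t with
  | nil => exact absurd rfl ht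
  | node c r => exact Nat.succ_pos _

theorem leaves_pos {t : RTree} (ht : t ≠ nil) : 0 < t.leaves := by
  induction t with
  | nil => exact absurd rfl ht
  | node c r ih _ =>
    cases c with
    | nil => simp [leaves]
    | node a b =>
      have := ih (by simp)
      simp only [leaves]
      omega

theorem leaves_le_edges (t : RTree) : t.leaves ≤ t.edges := by
  induction t with
  | nil => simp [leaves]
  | node c r ihc ihr =>
    cases c with
    | nil => simp only [leaves, edges]; omega
    | node a b => simp only [leaves, edges] at ihc ⊢; omega

theorem good_val (t : RTree) : Good t.val := by
  induction t with
  | nil => exact good_one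
  | node c r ihc ihr => exact ihc.grow.mul ihr

theorem eval_fst_pos (t : RTree) : 0 < t.val.fst.eval 1 := by
  induction t with
  | nil => simp [val]
  | node c r ihc ihr =>
    have := (good_val c).2.eval_one_nonneg
    simp only [val, mul_fst, fst_grow, eval_mul, eval_add, eval_X, eval_one]
    positivity

/-- Strictness in the theorem comes from here. Evaluation at `1` turns the claim into positivity of
a real number. -/
theorem snd_ne_zero {t : RTree} (ht : t ≠ nil) : t.val.snd ≠ 0 := by
  cases t with
  | nil => exact absurd rfl ht
  | node c r =>
    intro h
    have h1 := (good_val c).2.eval_one_nonneg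
    have h2 := (good_val r).2.eval_one_nonneg
    have h3 := eval_fst_pos c
    have h4 := eval_fst_pos r
    have h5 := congrArg (eval 1) h
    simp only [val, mul_snd, fst_grow, snd_grow, eval_mul, eval_add, eval_X, eval_one,
      eval_zero] at h5
    have : 0 < ((1 + 1) * eval 1 c.val.fst + eval 1 c.val.snd) * eval 1 r.val.snd +
      (1 * eval 1 c.val.fst + eval 1 c.val.snd) * eval 1 r.val.fst := by positivity
    linarith

/-- The leg lengths of the balanced starlike tree with as many edges and leaves as `t`. -/
def legs (t : RTree) : Multiset ℕ := balanced t.edges t.leaves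

theorem card_legs (t : RTree) : t.legs.card = t.leaves := card_balanced _ _

theorem sum_legs (t : RTree) : t.legs.sum = t.edges := by
  by_cases ht : t = nil
  · subst ht; simp [legs, balanced, leaves, edges]
  · exact sum_balanced _ (leaves_pos ht)

theorem legs_ne_zero {t : RTree} (ht : t ≠ nil) : t.legs ≠ 0 := by
  rw [← Multiset.card_pos, card_legs]
  exact leaves_pos ht

/-- A branch at the root is a path followed by a leaf or by a branching vertex. -/
theorem exists_branch (c : RTree) : ∃ (k : ℕ) (s : RTree), (s = nil ∨ 2 ≤ s.rootDegree) ∧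
    grow c.val = grow^[k + 1] s.val ∧ c.edges = s.edges + k ∧
    (s = nil → (node c nil).leaves = 1) ∧ (s ≠ nil → (node c nil).leaves = s.leaves) := by
  induction c with
  | nil => exact ⟨0, nil, by simp, rfl, by simp [edges], by simp [leaves], by simp⟩
  | node c r ihc _ =>
    cases r with
    | nil =>
      obtain ⟨k, s, hs, hval, he, h0, h1⟩ := ihc
      refine ⟨k + 1, s, hs, ?_, by simp [edges, he, add_assoc], fun h => ?_, fun h => ?_⟩
      · rw [Function.iterate_succ_apply', ← hval]
        simp [val]
      · simpa [leaves] using h0 h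
      · simpa [leaves] using h1 h
    | node a b =>
      exact ⟨0, node c (node a b), .inr (by simp [rootDegree]), rfl, rfl, by simp,
        fun _ => by simp [leaves]⟩

theorem two_le_rootDegree_ne_nil {t : RTree} (h : 2 ≤ t.rootDegree) : t ≠ nil := by
  rintro rfl
  simp [rootDegree] at h

/-- A leg attached to the root of a tree dominating its balanced starlike tree. -/
theorem phi_leg_mul {s : RTree} (hs : Dom s.val (spider s.legs)) (k : ℕ) {e l : ℕ}
    (he : e = k + s.edges) (hl : l = 1 + s.leaves) :
    CoeffNonneg (phi (leg k * s.val) - phi (spider (balanced e l))) := by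
  refine ((hs.mul_left _ (good_leg k)).trans ?_).1
  rw [← spider_cons]
  exact dom_balanced_of_eq (by rw [Multiset.sum_cons, sum_legs, he])
    (by rw [Multiset.card_cons, card_legs, hl, add_comm])

/-- The two ends are replaced by their spiders one after the other, and then `phi_two_centers`
merges the centers. -/
theorem phi_join {r s : RTree} (hr : Dom r.val (spider r.legs)) (hs : Dom s.val (spider s.legs))
    (hr' : r ≠ nil) (hs' : s ≠ nil) (k : ℕ) {e l : ℕ}
    (he : e = r.edges + s.edges + k) (hl : l = r.leaves + s.leaves) :
    CoeffNonneg (phi (r.val * grow^[k] s.val) - phi (spider (balanced e l))) := by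
  have h1 := ((hs.grow_iterate k).mul_left _ (good_val r)).1
  have h2 := (hr.mul_left _ ((good_spider s.legs).grow_iterate k)).1
  have h3 := phi_two_centers (legs_ne_zero hr') (legs_ne_zero hs') k
  rw [sum_legs, sum_legs, card_legs, card_legs, ← he, ← hl] at h3
  rw [mul_comm _ r.val, mul_comm _ (spider r.legs)] at h2
  simpa using (h1.add h2).add h3

/-- The degree condition is needed for `phi`: a root of degree one is a leaf that `leaves` does not
count. The star with three edges rooted at a leaf would be compared with a path, whose `phi` is
larger. The root minor does not have this defect, and its bound must hold for all roots to carry the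
induction through the factor `r`. -/
theorem compare_spider (t : RTree) :
    CoeffNonneg (t.val.fst - (spider t.legs).fst) ∧
      (2 ≤ t.rootDegree → Dom t.val (spider t.legs)) := by
  induction hN : t.edges using Nat.strong_induction_on generalizing t with
  | _ N ih =>
  cases t with
  | nil => simpa [val, legs, leaves, balanced, rootDegree] using CoeffNonneg.zero
  | node c r =>
  have hN' : c.edges + 1 + r.edges = N := hN
  obtain ⟨k, s, hs, hval, hek, h0, h1⟩ := exists_branch c
  have hval' : (node c r).val = grow^[k + 1] s.val * r.val := by rw [← hval]; rfl
  have hl := leaves_node c r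
  have hdomS : 2 ≤ s.rootDegree → Dom s.val (spider s.legs) :=
    (ih s.edges (by omega) s rfl).2
  have hr := ih r.edges (by omega) r rfl
  have hfst : CoeffNonneg ((node c r).val.fst - (spider (node c r).legs).fst) := by
    -- The root minor is multiplicative over branches, so the branch `c` is treated alone. It is
    -- either a leg, or a path to a branching vertex whose spider slides to the root except for one
    -- leg `p`, which absorbs the path and gets length `p + (k + 1)`.
    obtain ⟨m, hm, hm', hmb⟩ : ∃ m : Multiset ℕ, m.sum = c.edges + 1 ∧
        m.card = (node c nil).leaves ∧
        CoeffNonneg ((grow^[k + 1] s.val).fst - (spider m).fst) := by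
      obtain rfl | hs := hs
      · refine ⟨{k + 1}, by simp [hek, edges], by simp [h0], ?_⟩
        have : spider {k + 1} = grow^[k + 1] nil.val := by simp [spider, leg, val]
        rw [this, sub_self]
        exact CoeffNonneg.zero
      · have hne := two_le_rootDegree_ne_nil hs
        obtain ⟨p, hp⟩ := Multiset.exists_mem_of_ne_zero (legs_ne_zero hne)
        obtain ⟨m, hm⟩ := Multiset.exists_cons_of_mem hp
        have hsum := sum_legs s
        have hcard := card_legs s
        rw [hm] at hsum hcard
        simp only [Multiset.sum_cons, Multiset.card_cons] at hsum hcard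
        refine ⟨(p + (k + 1)) ::ₘ m, by simp only [Multiset.sum_cons]; omega, by
          rw [h1 hne]; simpa using hcard, ?_⟩
        have h2 := ((hdomS hs).grow_iterate (k + 1)).2
        have h3 := fst_grow_iterate_mul_sub (good_leg p) (good_spider m) (k + 1)
        rw [hm, spider_cons] at h2
        rw [grow_iterate_leg] at h3
        rw [spider_cons]
        simpa using h2.add h3
    have h2 := hmb.mul_sub_mul hr.1 (good_spider m).1 (good_val r).1
    have h3 := (dom_balanced_of_eq (m := m + r.legs) (e := (node c r).edges)
      (l := (node c r).leaves) (by rw [Multiset.sum_add, hm, sum_legs]; rfl)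
      (by rw [Multiset.card_add, hm', card_legs, hl])).2
    rw [spider_add, mul_fst] at h3
    rw [hval', mul_fst]
    simpa [legs] using h2.add h3
  refine ⟨hfst, fun hdeg => ⟨?_, hfst⟩⟩
  rw [hval']
  have he : (node c r).edges = c.edges + 1 + r.edges := rfl
  -- If `r` still branches at the root, the induction hypothesis gives full domination for `r`, and
  -- the first branch is a leg or leads to a second branching vertex.
  by_cases hr2 : 2 ≤ r.rootDegree
  · have hdr := hr.2 hr2
    obtain rfl | hs := hs
    · rw [h0 rfl] at hl
      refine phi_leg_mul hdr (k + 1) ?_ hl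
      rw [he, hek]; simp [edges]
    · have hne := two_le_rootDegree_ne_nil hs
      rw [mul_comm]
      refine phi_join hdr (hdomS hs) (two_le_rootDegree_ne_nil hr2) hne (k + 1) ?_ ?_
      · omega
      · rw [hl, h1 hne, add_comm]
  -- With root degree two the root is an interior vertex of a path between `s` and `s'`. As `phi`
  -- does not depend on the root, it is moved to an end of this path that branches, if there is one.
  · obtain ⟨c', rfl⟩ : ∃ c', r = node c' nil := by
      cases r with
      | nil => simp [rootDegree] at hdeg
      | node c' r' =>
        cases r' with
        | nil => exact ⟨c', rfl⟩
        | node a b => simp [rootDegree] at hr2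
    obtain ⟨k', s', hs', hval2, hek', h0', h1'⟩ := exists_branch c'
    have hval3 : (node c' nil).val = grow^[k' + 1] s'.val := by rw [← hval2]; simp [val]
    have he' : (node c' nil).edges = c'.edges + 1 := rfl
    have hdomS' : 2 ≤ s'.rootDegree → Dom s'.val (spider s'.legs) :=
      (ih s'.edges (by omega) s' rfl).2
    have hnil : edges nil = 0 := rfl
    rw [hval3]
    obtain rfl | hs := hs
    · obtain rfl | hs' := hs'
      · have h2 := (dom_balanced_of_eq (m := {k + 1, k' + 1})
          (e := (node c (node c' nil)).edges) (l := (node c (node c' nil)).leaves)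
          (by simp; omega) (by simp [hl, h0, h0'])).1
        simpa [spider, leg, val, legs] using h2
      · rw [h0 rfl, h1' (two_le_rootDegree_ne_nil hs')] at hl
        rw [phi_mul_grow_iterate, ← Function.iterate_add_apply]
        exact phi_leg_mul (hdomS' hs') (k' + 1 + (k + 1)) (by omega) hl
    · have hne := two_le_rootDegree_ne_nil hs
      rw [h1 hne] at hl
      obtain rfl | hs' := hs'
      · rw [h0' rfl] at hl
        rw [mul_comm, phi_mul_grow_iterate, ← Function.iterate_add_apply]
        exact phi_leg_mul (hdomS hs) (k + 1 + (k' + 1)) (by omega) (by omega)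
      · have hne' := two_le_rootDegree_ne_nil hs'
        rw [h1' hne'] at hl
        rw [← phi_mul_grow_iterate, ← Function.iterate_add_apply]
        exact phi_join (hdomS hs) (hdomS' hs') hne hne' _ (by omega) hl

end RTree
end LapUnicyclic

/-! ### Determinants of coupled blocks. -/

namespace LapUnicyclic
open Polynomial Matrix

section Det

variable {ι κ : Type*} [Fintype ι] [DecidableEq ι] [Fintype κ] [DecidableEq κ]

theorem det_add_single {R : Type*} [CommRing R] (M : Matrix ι ι R) (r : ι) (y : R) :
    (M + single r r y).det = M.det + y * M.adjugate r r := by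
  have h : M + single r r y = M.updateRow r (M r + y • Pi.single r 1) := by
    ext i j
    by_cases hi : i = r
    · subst hi
      by_cases hj : j = i
      · subst hj; simp
      · simp [hj, Ne.symm hj]
    · simp [hi, Ne.symm hi]
  rw [h, det_updateRow_add, det_updateRow_smul, updateRow_eq_self, adjugate_apply]

theorem adjugate_add_single {R : Type*} [CommRing R] (M : Matrix ι ι R) (r : ι) (y : R) :
    (M + single r r y).adjugate r r = M.adjugate r r := by
  rw [adjugate_apply, adjugate_apply]
  congr 1
  ext i j
  by_cases hi : i = r
  · subst hi; simp
  · simp [hi, Ne.symm hi]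

theorem det_mul_inv_apply {F : Type*} [Field F] (M : Matrix ι ι F) (h : M.det ≠ 0) (i j : ι) :
    M.det * M⁻¹ i j = M.adjugate i j := by
  rw [inv_def, Matrix.smul_apply, smul_eq_mul, Ring.inverse_eq_inv', mul_inv_cancel_left₀ h]

theorem det_blockDiagonal_sigma {R : Type*} [CommRing R] {K : Type*} [Fintype K] [LinearOrder K]
    {W : K → Type*} [∀ k, Fintype (W k)] [∀ k, DecidableEq (W k)]
    (M : ∀ k, Matrix (W k) (W k) R) : (blockDiagonal' M).det = ∏ k, (M k).det := by
  rw [(blockTriangular_blockDiagonal' M).det_fintype]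
  refine Finset.prod_congr rfl fun k _ => ?_
  rw [← det_submatrix_equiv_self (Equiv.sigmaSubtype (β := W) k).symm (toSquareBlock _ _ _)]
  congr 1
  ext i j
  simp [toSquareBlock_def, Equiv.sigmaSubtype]

/-- Determinant of a block diagonal matrix whose blocks are coupled through one chosen index each,
over a field. -/
theorem det_blockDiagonal_add_field {F : Type*} [Field F] {K : Type*} [Fintype K] [LinearOrder K]
    {W : K → Type*} [∀ k, Fintype (W k)] [∀ k, DecidableEq (W k)]
    (M : ∀ k, Matrix (W k) (W k) F) (hM : ∀ k, (M k).det ≠ 0) (r : ∀ k, W k) (N : Matrix K K F) :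
    (blockDiagonal' M + of fun p q : Σ k, W k =>
      if p.2 = r p.1 ∧ q.2 = r q.1 then N p.1 q.1 else 0).det =
    (diagonal (fun k => (M k).det) +
      N * diagonal fun k => (M k).adjugate (r k) (r k)).det := by
  -- `U` embeds the chosen indices, so the coupling is `U * N * Uᵀ` and the matrix determinant lemma
  -- reduces everything to size `K`.
  let U : Matrix (Σ k, W k) K F := of fun p k => if p = ⟨k, r k⟩ then 1 else 0
  have hU : ∀ p k, U p k = if p = ⟨k, r k⟩ then 1 else 0 := fun _ _ => rfl
  have h1 : (of fun p q : Σ k, W k => if p.2 = r p.1 ∧ q.2 = r q.1 then N p.1 q.1 else 0) =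
      U * (N * Uᵀ) := by
    ext ⟨i, x⟩ ⟨j, y⟩
    have e : ∀ (i : K) (x : W i) (k : K), ((⟨i, x⟩ : Σ k, W k) = ⟨k, r k⟩) ↔ k = i ∧ x = r i := by
      intro i x k
      constructor
      · intro h
        obtain ⟨rfl, h⟩ := Sigma.mk.inj_iff.1 h
        exact ⟨rfl, eq_of_heq h⟩
      · rintro ⟨rfl, rfl⟩; rfl
    simp only [mul_apply, transpose_apply, hU, e, of_apply]
    by_cases hx : x = r i <;> by_cases hy : y = r j <;> simp [hx, hy]
  have hdet : (blockDiagonal' M).det ≠ 0 := by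
    rw [det_blockDiagonal_sigma]
    exact Finset.prod_ne_zero_iff.2 fun k _ => hM k
  have hinv : (blockDiagonal' M)⁻¹ = blockDiagonal' fun k => (M k)⁻¹ := by
    refine inv_eq_right_inv ?_
    rw [← blockDiagonal'_mul]
    have : (fun k => M k * (M k)⁻¹) = 1 := funext fun k =>
      mul_nonsing_inv _ (isUnit_iff_ne_zero.2 (hM k))
    rw [this, blockDiagonal'_one]
  have h2 : Uᵀ * ((blockDiagonal' M)⁻¹ * U) = diagonal fun k => (M k)⁻¹ (r k) (r k) := by
    rw [hinv]
    ext i j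
    simp only [mul_apply, transpose_apply, hU]
    simp only [ite_mul, one_mul, zero_mul, mul_ite, mul_one, mul_zero, Finset.sum_ite_eq',
      Finset.mem_univ, if_true]
    by_cases hij : i = j
    · subst hij; simp
    · rw [diagonal_apply_ne _ hij, blockDiagonal'_apply_ne _ _ _ hij]
  rw [h1, det_add_mul _ _ (isUnit_iff_ne_zero.2 hdet), Matrix.mul_assoc, Matrix.mul_assoc, h2,
    det_blockDiagonal_sigma, mul_comm, ← det_diagonal, ← det_mul, Matrix.add_mul, Matrix.one_mul,
    Matrix.mul_assoc, diagonal_mul_diagonal]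
  congr 4
  funext k
  rw [mul_comm, det_mul_inv_apply _ (hM k)]

theorem det_blockDiagonal_add_of_injective {R F : Type*} [CommRing R] [Field F] (f : R →+* F)
    (hf : Function.Injective f) {K : Type*} [Fintype K]
    [LinearOrder K] {W : K → Type*} [∀ k, Fintype (W k)] [∀ k, DecidableEq (W k)]
    (M : ∀ k, Matrix (W k) (W k) R) (hM : ∀ k, (M k).det ≠ 0) (r : ∀ k, W k) (N : Matrix K K R) :
    (blockDiagonal' M + of fun p q : Σ k, W k =>
      if p.2 = r p.1 ∧ q.2 = r q.1 then N p.1 q.1 else 0).det =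
    (diagonal (fun k => (M k).det) +
      N * diagonal fun k => (M k).adjugate (r k) (r k)).det := by
  have hdet : ∀ k, ((M k).map f).det = f (M k).det := fun k => (f.map_det (M k)).symm
  have hadj : ∀ k, ((M k).map f).adjugate = (M k).adjugate.map f := fun k =>
    (f.map_adjugate (M k)).symm
  have h := det_blockDiagonal_add_field (fun k => (M k).map f) (fun k => by
    rw [hdet, Ne, map_eq_zero_iff f hf]; exact hM k) r (N.map f)
  simp only [hdet, hadj] at h
  apply hf
  rw [f.map_det, f.map_det]
  have e1 : f.mapMatrix (blockDiagonal' M + of fun p q : Σ k, W k =>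
      if p.2 = r p.1 ∧ q.2 = r q.1 then N p.1 q.1 else 0) =
      (blockDiagonal' fun k => (M k).map f) + of fun p q : Σ k, W k =>
      if p.2 = r p.1 ∧ q.2 = r q.1 then N.map f p.1 q.1 else 0 := by
    ext ⟨i, x⟩ ⟨j, y⟩
    simp only [RingHom.mapMatrix_apply, map_apply, Matrix.add_apply, of_apply, map_add,
      apply_ite f, map_zero]
    congr 1
    by_cases hij : i = j
    · subst hij; simp
    · simp [blockDiagonal'_apply_ne _ _ _ hij]
  have e2 : f.mapMatrix (diagonal (fun k => (M k).det) +
      N * diagonal fun k => (M k).adjugate (r k) (r k)) =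
      diagonal (fun k => f (M k).det) +
      N.map f * diagonal fun k => (M k).adjugate.map f (r k) (r k) := by
    rw [map_add, map_mul]
    simp only [RingHom.mapMatrix_apply, diagonal_map (map_zero f)]
    rfl
  rw [e1, e2, h]

/-- A block enters only through its determinant and one minor. The identity is checked in the
fraction field, where the blocks become invertible. -/
theorem det_blockDiagonal_add {R : Type*} [CommRing R] [IsDomain R] {K : Type*} [Fintype K]
    [LinearOrder K] {W : K → Type*} [∀ k, Fintype (W k)] [∀ k, DecidableEq (W k)]
    (M : ∀ k, Matrix (W k) (W k) R) (hM : ∀ k, (M k).det ≠ 0) (r : ∀ k, W k) (N : Matrix K K R) :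
    (blockDiagonal' M + of fun p q : Σ k, W k =>
      if p.2 = r p.1 ∧ q.2 = r q.1 then N p.1 q.1 else 0).det =
    (diagonal (fun k => (M k).det) +
      N * diagonal fun k => (M k).adjugate (r k) (r k)).det :=
  det_blockDiagonal_add_of_injective (algebraMap R (FractionRing R))
    (IsFractionRing.injective R (FractionRing R)) M hM r N

/-- Schur complement for a block coupled to one index of the other block. -/
theorem det_fromBlocks_single {F : Type*} [Field F] (A : Matrix ι ι F) (D : Matrix κ κ F)
    (hD : D.det ≠ 0) (r : ι) (p q : κ → F) :
    (fromBlocks A (of fun i j => if i = r then p j else 0)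
      (of fun j i => if i = r then q j else 0) D).det =
    D.det * (A.det - (p ⬝ᵥ D⁻¹ *ᵥ q) * A.adjugate r r) := by
  let _ : Invertible D := invertibleOfIsUnitDet D (isUnit_iff_ne_zero.2 hD)
  rw [det_fromBlocks₂₂, invOf_eq_nonsing_inv]
  congr 1
  have : A - (of fun i j => if i = r then p j else 0) * D⁻¹ *
      (of fun j i => if i = r then q j else 0) = A + single r r (-(p ⬝ᵥ D⁻¹ *ᵥ q)) := by
    rw [sub_eq_add_neg]
    congr 1
    ext i j
    rw [Matrix.mul_assoc, neg_apply, mul_apply]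
    by_cases hi : i = r
    · by_cases hj : j = r
      · subst hi hj
        simp [dotProduct, mulVec, mul_apply]
      · simp [hi, hj, Ne.symm hj, mul_apply]
    · simp [hi, Ne.symm hi]
  rw [this, det_add_single]
  ring

end Det

/-! ### Nonnegative coefficients from positive semidefiniteness. -/

section Nonneg

theorem det_ite_one {ι R : Type*} [Fintype ι] [DecidableEq ι] [CommRing R]
    (M : Matrix ι ι R) (s : ι → Prop) [DecidablePred s] :
    (of fun i j => if s i then M i j else if i = j then 1 else 0).det =
      (M.submatrix (Subtype.val : {i // s i} → ι) Subtype.val).det := by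
  rw [twoBlockTriangular_det _ s]
  · have h1 : toSquareBlockProp (of fun i j => if s i then M i j else if i = j then 1 else 0)
        (fun i => ¬ s i) = 1 := by
      ext i j
      simp [toSquareBlockProp, i.2, one_apply, Subtype.ext_iff]
    have h2 : toSquareBlockProp (of fun i j => if s i then M i j else if i = j then 1 else 0) s =
        M.submatrix (Subtype.val : {i // s i} → ι) Subtype.val := by
      ext i j
      simp [toSquareBlockProp, i.2]
    rw [h1, h2, det_one, mul_one]
  · intro i hi j hj
    have : i ≠ j := by rintro rfl; exact hi hj
    simp [hi, this]

theorem adjugate_apply_self {ι R : Type*} [Fintype ι] [DecidableEq ι] [CommRing R]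
    (M : Matrix ι ι R) (u : ι) :
    M.adjugate u u = (M.submatrix (Subtype.val : {i // i ≠ u} → ι) Subtype.val).det := by
  rw [← det_ite_one M (fun i => i ≠ u), adjugate_apply]
  congr 1
  ext i j
  by_cases hi : i = u
  · subst hi; simp [Pi.single_apply, eq_comm]
  · simp [hi]

/-- The determinant is affine in each diagonal entry, with slope a principal minor of the same
shape. Removing nonzero entries `d u` one by one leaves determinants of positive semidefinite real
matrices. -/
theorem CoeffNonneg.det_add_diagonal {ι : Type*} [Fintype ι] [DecidableEq ι] (B : Matrix ι ι ℝ)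
    (hB : B.PosSemidef) (d : ι → ℝ[X]) (hd : ∀ i, CoeffNonneg (d i)) :
    CoeffNonneg (B.map Polynomial.C + diagonal d).det := by
  induction hN : (Finset.univ.filter fun i => d i ≠ 0).card using Nat.strong_induction_on
    generalizing ι with
  | _ N ih =>
  by_cases h : ∃ u, d u ≠ 0
  · obtain ⟨u, hu⟩ := h
    have h1 : B.map Polynomial.C + diagonal d =
        (B.map Polynomial.C + diagonal (Function.update d u 0)) + single u u (d u) := by
      rw [add_assoc]
      congr 1
      ext1 i j
      by_cases hij : i = j
      · subst hij
        by_cases hi : i = u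
        · subst hi; simp
        · simp [hi, Ne.symm hi]
      · have : ¬ (u = i ∧ u = j) := by rintro ⟨rfl, rfl⟩; exact hij rfl
        simp [hij, this]
    rw [h1, det_add_single]
    refine (ih _ ?_ B hB _ ?_ rfl).add ((hd u).mul ?_)
    · rw [← hN]
      refine Finset.card_lt_card (Finset.ssubset_iff_of_subset ?_ |>.2
        ⟨u, by simpa using hu, by simp⟩)
      intro i
      by_cases hi : i = u
      · subst hi; simp
      · simp [hi]
    · intro i
      by_cases hi : i = u
      · subst hi; simpa using CoeffNonneg.zero
      · simpa [hi] using hd i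
    · rw [adjugate_apply_self]
      have h2 : (B.map Polynomial.C + diagonal (Function.update d u 0)).submatrix
          (Subtype.val : {i // i ≠ u} → ι) Subtype.val =
          (B.submatrix (Subtype.val : {i // i ≠ u} → ι) Subtype.val).map Polynomial.C +
          diagonal fun i : {i // i ≠ u} => d i := by
        ext1 i j
        simp [diagonal_apply, i.2, Subtype.ext_iff]
      rw [h2]
      refine ih _ ?_ _ (hB.submatrix _) _ (fun i => hd i) rfl
      rw [← hN, ← Finset.card_map (Function.Embedding.subtype _)]
      refine Finset.card_lt_card (Finset.ssubset_iff_of_subset ?_ |>.2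
        ⟨u, by simpa using hu, by simp⟩)
      intro i
      simp only [Finset.mem_map, Finset.mem_filter, Finset.mem_univ, true_and]
      rintro ⟨j, hj, rfl⟩
      exact hj
  · push Not at h
    have : B.map Polynomial.C + diagonal d = Polynomial.C.mapMatrix B := by
      ext1 i j
      simp [diagonal_apply, h]
    rw [this, ← RingHom.map_det]
    exact CoeffNonneg.C hB.det_nonneg

end Nonneg
end LapUnicyclic

/-! ### The Laplacian matrix and the pair of a rooted graph. -/

namespace LapUnicyclic
open Polynomial Matrix

section Laplacian

variable {V W : Type*} [Fintype V] [Fintype W]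

/-- The degree of a vertex. -/
noncomputable def deg (G : SimpleGraph V) (v : V) : ℕ := open Classical in G.degree v

/-- The Laplacian matrix. -/
noncomputable def lapl (G : SimpleGraph V) : Matrix V V ℝ := open Classical in G.lapMatrix ℝ

theorem lapl_self (G : SimpleGraph V) (v : V) : lapl G v v = deg G v := by
  classical
  simp [lapl, deg, SimpleGraph.lapMatrix, SimpleGraph.degMatrix]

open Classical in
theorem lapl_of_ne (G : SimpleGraph V) {v w : V} (h : v ≠ w) :
    lapl G v w = if G.Adj v w then -1 else 0 := by
  simp only [lapl, SimpleGraph.lapMatrix, SimpleGraph.degMatrix, Matrix.sub_apply,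
    diagonal_apply_ne _ h, SimpleGraph.adjMatrix_apply]
  split_ifs <;> simp

theorem lapl_sum (G : SimpleGraph V) (v : V) : ∑ w, lapl G v w = 0 := by
  classical
  have h := congrFun (G.lapMatrix_mulVec_const_eq_zero (R := ℝ)) v
  simpa [mulVec, dotProduct, lapl] using h

open Classical in
/-- The Laplacian matrix is determined by its off-diagonal entries and its row sums. -/
theorem lapl_eq (G : SimpleGraph V) (M : Matrix V V ℝ)
    (h : ∀ v w, v ≠ w → M v w = if G.Adj v w then -1 else 0) (hs : ∀ v, ∑ w, M v w = 0) :
    lapl G = M := by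
  have h' : ∀ v w, v ≠ w → lapl G v w = M v w := fun v w hvw => by
    rw [lapl_of_ne G hvw, h v w hvw]
  ext v w
  by_cases hvw : v = w
  · subst hvw
    have h1 := lapl_sum G v
    rw [← hs v, ← Finset.add_sum_erase _ _ (Finset.mem_univ v),
      ← Finset.add_sum_erase _ (M v) (Finset.mem_univ v),
      Finset.sum_congr rfl fun w hw => h' v w (Finset.ne_of_mem_erase hw).symm] at h1
    exact add_right_cancel h1
  · exact h' v w hvw

theorem lapl_posSemidef (G : SimpleGraph V) : (lapl G).PosSemidef := by
  classical
  exact G.posSemidef_lapMatrix ℝ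

theorem lapl_submatrix {G : SimpleGraph V} {H : SimpleGraph W} (f : G ≃g H) :
    (lapl H).submatrix f f = lapl G := by
  classical
  refine (lapl_eq G _ (fun v w h => ?_) fun v => ?_).symm
  · rw [submatrix_apply, lapl_of_ne H (f.injective.ne h)]
    simp only [f.map_adj_iff]
  · simp only [submatrix_apply]
    rw [← lapl_sum H (f v)]
    exact f.toEquiv.sum_comp (fun w => lapl H (f v) w)

theorem deg_iso {G : SimpleGraph V} {H : SimpleGraph W} (f : G ≃g H) (v : V) :
    deg H (f v) = deg G v := by
  have h := congrFun (congrFun (lapl_submatrix f) v) v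
  rw [submatrix_apply, lapl_self, lapl_self] at h
  exact_mod_cast h

/-- The matrix `X I + L(G)`. -/
noncomputable def charM [DecidableEq V] (G : SimpleGraph V) : Matrix V V ℝ[X] :=
  (lapl G).map Polynomial.C + diagonal fun _ => X

theorem charM_submatrix [DecidableEq V] [DecidableEq W] {G : SimpleGraph V} {H : SimpleGraph W}
    (f : G ≃g H) : (charM H).submatrix f f = charM G := by
  rw [charM, charM, ← lapl_submatrix f]
  ext1 v w
  simp [diagonal_apply, f.injective.eq_iff]

theorem charM_det_eq_charpoly [DecidableEq V] (G : SimpleGraph V) :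
    (charM G).det = (-lapl G).charpoly := by
  rw [Matrix.charpoly]
  congr 1
  ext1 v w
  by_cases h : v = w
  · subst h; simp [charM, add_comm]
  · simp [charM, h]

theorem charM_det_ne_zero [DecidableEq V] (G : SimpleGraph V) : (charM G).det ≠ 0 := by
  rw [charM_det_eq_charpoly]
  exact (Matrix.charpoly_monic _).ne_zero

theorem charM_det_coeff_of_lt [DecidableEq V] (G : SimpleGraph V) {k : ℕ}
    (h : Fintype.card V < k) : (charM G).det.coeff k = 0 := by
  rw [charM_det_eq_charpoly]
  refine coeff_eq_zero_of_natDegree_lt ?_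
  rwa [Matrix.charpoly_natDegree_eq_dim]

theorem charM_det_eq_comp [DecidableEq V] (G : SimpleGraph V) :
    (charM G).det = (-1) ^ Fintype.card V *
      (lapl G).charpoly.comp (Polynomial.C (-1) * X) := by
  rw [Matrix.charpoly, ← coe_compRingHom_apply, RingHom.map_det, ← det_neg]
  congr 1
  ext1 v w
  by_cases h : v = w
  · subst h; simp [charM, add_comm]
  · simp [charM, h]

/-- Substituting `-X` for `X` in the characteristic polynomial absorbs the signs `(-1) ^ k`. -/
theorem lapCoeff_eq [DecidableEq V] (G : SimpleGraph V) {k : ℕ} (hk : k ≤ Fintype.card V) :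
    lapCoeff G k = (charM G).det.coeff (Fintype.card V - k) := by
  have h : (-1 : ℝ[X]) ^ Fintype.card V = Polynomial.C ((-1) ^ Fintype.card V) := by simp
  have h0 : lapCoeff G k = (-1) ^ k * (lapl G).charpoly.coeff (Fintype.card V - k) := by
    unfold lapCoeff lapl
    congr!
  rw [charM_det_eq_comp, h, coeff_C_mul, comp_C_mul_X_coeff, h0]
  obtain ⟨j, hj⟩ := Nat.exists_eq_add_of_le hk
  rw [hj, Nat.add_sub_cancel_left]
  have h2 : ((-1 : ℝ) ^ j) * (-1) ^ j = 1 := by rw [← mul_pow]; simp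
  rw [pow_add]
  linear_combination (-(-1) ^ k * (lapl G).charpoly.coeff j) * h2

/-- The pair of a rooted graph. -/
noncomputable def rootPair [DecidableEq V] (G : SimpleGraph V) (r : V) : RootPair :=
  (((charM G).adjugate r r, (charM G).det - X * (charM G).adjugate r r) : ℝ[X] × ℝ[X])

theorem rootPair_fst [DecidableEq V] (G : SimpleGraph V) (r : V) :
    (rootPair G r).fst = (charM G).adjugate r r := rfl

theorem rootPair_snd [DecidableEq V] (G : SimpleGraph V) (r : V) :
    (rootPair G r).snd = (charM G).det - X * (charM G).adjugate r r := rfl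

theorem phi_rootPair [DecidableEq V] (G : SimpleGraph V) (r : V) :
    RootPair.phi (rootPair G r) = (charM G).det := by
  rw [RootPair.phi, rootPair_fst, rootPair_snd]; ring

theorem charM_det_iso [DecidableEq V] [DecidableEq W] {G : SimpleGraph V} {H : SimpleGraph W}
    (f : G ≃g H) : (charM H).det = (charM G).det := by
  rw [← charM_submatrix f]
  exact (det_submatrix_equiv_self f.toEquiv _).symm

theorem rootPair_iso [DecidableEq V] [DecidableEq W] {G : SimpleGraph V} {H : SimpleGraph W}
    (f : G ≃g H) (r : V) : rootPair H (f r) = rootPair G r := by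
  have h : (charM H).adjugate (f r) (f r) = (charM G).adjugate r r := by
    rw [← charM_submatrix f]
    exact (congrFun (congrFun (adjugate_submatrix_equiv_self f.toEquiv (charM H)) r) r).symm
  rw [rootPair, rootPair, h, charM_det_iso f]

theorem coeffNonneg_det [DecidableEq V] (G : SimpleGraph V) : CoeffNonneg (charM G).det :=
  CoeffNonneg.det_add_diagonal _ (lapl_posSemidef G) _ fun _ => CoeffNonneg.X

theorem charM_submatrix_val [DecidableEq V] (G : SimpleGraph V) (s : V → Prop) [DecidablePred s] :
    (charM G).submatrix (Subtype.val : {v // s v} → V) Subtype.val =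
    ((lapl G).submatrix (Subtype.val : {v // s v} → V) Subtype.val).map Polynomial.C +
      diagonal fun _ => X := by
  ext1 i j
  simp [charM, diagonal_apply, Subtype.ext_iff]

theorem coeffNonneg_minor [DecidableEq V] (G : SimpleGraph V) (s : V → Prop) [DecidablePred s] :
    CoeffNonneg ((charM G).submatrix (Subtype.val : {v // s v} → V) Subtype.val).det := by
  rw [charM_submatrix_val]
  exact CoeffNonneg.det_add_diagonal _ ((lapl_posSemidef G).submatrix _) _ fun _ => CoeffNonneg.X

theorem minor_ne_zero [DecidableEq V] (G : SimpleGraph V) (s : V → Prop) [DecidablePred s] :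
    ((charM G).submatrix (Subtype.val : {v // s v} → V) Subtype.val).det ≠ 0 := by
  rw [charM_submatrix_val]
  have : ((lapl G).submatrix (Subtype.val : {v // s v} → V) Subtype.val).map Polynomial.C +
      (diagonal fun _ => X) =
      charmatrix (-(lapl G).submatrix (Subtype.val : {v // s v} → V) Subtype.val) := by
    ext1 v w
    by_cases h : v = w
    · subst h; simp [add_comm]
    · simp [h]
  rw [this]
  exact (Matrix.charpoly_monic _).ne_zero

/-- The second component is itself a determinant: that of `X I + L(G)` with the `X` at the root
erased. -/
theorem good_rootPair [DecidableEq V] (G : SimpleGraph V) (r : V) :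
    RootPair.Good (rootPair G r) := by
  refine ⟨?_, ?_⟩
  · rw [rootPair_fst, adjugate_apply_self]
    exact coeffNonneg_minor G _
  · have h : charM G + single r r (-X) =
        (lapl G).map Polynomial.C + diagonal fun v => if v = r then 0 else X := by
      rw [charM, add_assoc]
      congr 1
      ext1 i j
      by_cases hij : i = j
      · subst hij
        by_cases hi : i = r
        · subst hi; simp
        · simp [hi, Ne.symm hi]
      · have : ¬ (r = i ∧ r = j) := by rintro ⟨rfl, rfl⟩; exact hij rfl
        simp [hij, this]
    have h2 := det_add_single (charM G) r (-X)
    rw [rootPair_snd, sub_eq_add_neg, ← neg_mul, ← h2, h]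
    refine CoeffNonneg.det_add_diagonal _ (lapl_posSemidef G) _ fun v => ?_
    split_ifs
    · exact CoeffNonneg.zero
    · exact CoeffNonneg.X

end Laplacian
end LapUnicyclic

/-! ### Schur complements and joining two graphs by an edge. -/

namespace LapUnicyclic
open Polynomial Matrix

section Schur

variable {ι κ : Type*} [Fintype ι] [DecidableEq ι] [Fintype κ] [DecidableEq κ]

theorem det_fromBlocks_adjugate_of_injective {R F : Type*} [CommRing R] [Field F] (f : R →+* F)
    (hf : Function.Injective f) (A : Matrix ι ι R) (D : Matrix κ κ R)
    (hD : D.det ≠ 0) (r : ι) (p q : κ → R) :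
    (fromBlocks A (of fun i j => if i = r then p j else 0)
      (of fun j i => if i = r then q j else 0) D).det =
    D.det * A.det - (p ⬝ᵥ D.adjugate *ᵥ q) * A.adjugate r r := by
  have hdet : (D.map f).det = f D.det := (f.map_det D).symm
  have hD' : (D.map f).det ≠ 0 := by rwa [hdet, Ne, map_eq_zero_iff f hf]
  have h := det_fromBlocks_single (A.map f) (D.map f) hD' r (f ∘ p) (f ∘ q)
  apply hf
  rw [f.map_det]
  have e1 : f.mapMatrix (fromBlocks A (of fun i j => if i = r then p j else 0)
      (of fun j i => if i = r then q j else 0) D) =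
      fromBlocks (A.map f) (of fun i j => if i = r then (f ∘ p) j else 0)
      (of fun j i => if i = r then (f ∘ q) j else 0) (D.map f) := by
    rw [RingHom.mapMatrix_apply, fromBlocks_map]
    congr 1 <;> ext i j <;> simp [apply_ite f]
  have e2 : (D.map f).det * ((f ∘ p) ⬝ᵥ (D.map f)⁻¹ *ᵥ (f ∘ q)) =
      f (p ⬝ᵥ D.adjugate *ᵥ q) := by
    rw [RingHom.map_dotProduct, ← smul_eq_mul, ← dotProduct_smul, ← smul_mulVec]
    congr 1
    funext x
    rw [Function.comp_apply, RingHom.map_mulVec]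
    congr 1
    have : (D.map f).det • (D.map f)⁻¹ = (D.map f).adjugate := by
      ext i j
      exact det_mul_inv_apply _ hD' i j
    rw [this]
    exact (f.map_adjugate D).symm
  have e3 : (A.map f).adjugate r r = f (A.adjugate r r) :=
    (congrFun (congrFun (f.map_adjugate A) r) r).symm
  have e4 : (A.map f).det = f A.det := (f.map_det A).symm
  rw [e1, h, mul_sub, ← mul_assoc, e2, e3, e4, hdet, map_sub, map_mul, map_mul]

/-- Determinant of a block matrix one block of which is coupled to a single index of the other. -/
theorem det_fromBlocks_adjugate {R : Type*} [CommRing R] [IsDomain R] (A : Matrix ι ι R)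
    (D : Matrix κ κ R) (hD : D.det ≠ 0) (r : ι) (p q : κ → R) :
    (fromBlocks A (of fun i j => if i = r then p j else 0)
      (of fun j i => if i = r then q j else 0) D).det =
    D.det * A.det - (p ⬝ᵥ D.adjugate *ᵥ q) * A.adjugate r r :=
  det_fromBlocks_adjugate_of_injective (algebraMap R (FractionRing R))
    (IsFractionRing.injective R (FractionRing R)) A D hD r p q

end Schur

section JoinEdge

variable {V W : Type*}

/-- Two disjoint graphs joined by an edge. -/
def joinEdge (G : SimpleGraph V) (r : V) (H : SimpleGraph W) (c : W) : SimpleGraph (V ⊕ W) where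
  Adj
    | .inl v, .inl v' => G.Adj v v'
    | .inr w, .inr w' => H.Adj w w'
    | .inl v, .inr w => v = r ∧ w = c
    | .inr w, .inl v => v = r ∧ w = c
  symm := ⟨by
    rintro (v | w) (v' | w') h
    · exact SimpleGraph.Adj.symm (G := G) h
    · exact h
    · exact h
    · exact SimpleGraph.Adj.symm (G := H) h⟩
  loopless := ⟨by
    rintro (v | w) h
    · exact G.loopless.irrefl v h
    · exact H.loopless.irrefl w h⟩

variable [Fintype V] [Fintype W] [DecidableEq V] [DecidableEq W]

theorem lapl_joinEdge (G : SimpleGraph V) (r : V) (H : SimpleGraph W) (c : W) :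
    lapl (joinEdge G r H c) = fromBlocks (lapl G + single r r 1)
      (of fun v w => if v = r then (if w = c then -1 else 0) else 0)
      (of fun w v => if v = r then (if w = c then -1 else 0) else 0)
      (lapl H + single c c 1) := by
  classical
  apply lapl_eq
  · rintro (v | w) (v' | w') h
    · have h' : v ≠ v' := fun e => h (congrArg _ e)
      have : ¬ (r = v ∧ r = v') := by rintro ⟨rfl, rfl⟩; exact h' rfl
      simp only [fromBlocks_apply₁₁, Matrix.add_apply, lapl_of_ne G h', single_apply, this,
        if_false, add_zero]
      rfl
    · simp [joinEdge]; split_ifs <;> simp_all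
    · simp [joinEdge]; split_ifs <;> simp_all
    · have h' : w ≠ w' := fun e => h (congrArg _ e)
      have : ¬ (c = w ∧ c = w') := by rintro ⟨rfl, rfl⟩; exact h' rfl
      simp only [fromBlocks_apply₂₂, Matrix.add_apply, lapl_of_ne H h', single_apply, this,
        if_false, add_zero]
      rfl
  · rintro (v | w)
    · by_cases h : v = r
      · subst h; simp [Finset.sum_add_distrib, lapl_sum, single_apply]
      · simp [lapl_sum, h, Ne.symm h]
    · by_cases h : w = c
      · subst h; simp [Finset.sum_add_distrib, lapl_sum, single_apply]
      · simp [lapl_sum, h, Ne.symm h]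

theorem deg_joinEdge_inl (G : SimpleGraph V) (r : V) (H : SimpleGraph W) (c : W) (v : V) :
    deg (joinEdge G r H c) (.inl v) = deg G v + if v = r then 1 else 0 := by
  have h := congrFun (congrFun (lapl_joinEdge G r H c) (.inl v)) (.inl v)
  rw [lapl_self, fromBlocks_apply₁₁, Matrix.add_apply, lapl_self, single_apply] at h
  by_cases hv : v = r
  · subst hv
    simp only [and_self, if_true] at h ⊢
    exact_mod_cast h
  · simp only [Ne.symm hv, hv, and_self, if_false, add_zero] at h ⊢
    exact_mod_cast h

theorem deg_joinEdge_inr (G : SimpleGraph V) (r : V) (H : SimpleGraph W) (c : W) (w : W) :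
    deg (joinEdge G r H c) (.inr w) = deg H w + if w = c then 1 else 0 := by
  have h := congrFun (congrFun (lapl_joinEdge G r H c) (.inr w)) (.inr w)
  rw [lapl_self, fromBlocks_apply₂₂, Matrix.add_apply, lapl_self, single_apply] at h
  by_cases hv : w = c
  · subst hv
    simp only [and_self, if_true] at h ⊢
    exact_mod_cast h
  · simp only [Ne.symm hv, hv, and_self, if_false, add_zero] at h ⊢
    exact_mod_cast h

theorem fst_grow_rootPair (H : SimpleGraph W) (c : W) :
    (RootPair.grow (rootPair H c)).fst = (charM H + single c c 1).det := by
  rw [det_add_single, RootPair.fst_grow, rootPair_fst, rootPair_snd]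
  ring

theorem fst_grow_rootPair_ne_zero (H : SimpleGraph W) (c : W) :
    (charM H + single c c 1).det ≠ 0 := by
  intro h0
  rw [det_add_single, one_mul] at h0
  have h1 := (good_rootPair H c).1
  rw [rootPair_fst] at h1
  refine charM_det_ne_zero H (Polynomial.ext fun k => ?_)
  have h2 := congrArg (fun p => p.coeff k) h0
  simp only [coeff_add, coeff_zero] at h2 ⊢
  linarith [h1 k, coeffNonneg_det H k]

theorem rootPair_joinEdge (G : SimpleGraph V) (r : V) (H : SimpleGraph W) (c : W) :
    rootPair (joinEdge G r H c) (.inl r) = RootPair.grow (rootPair H c) * rootPair G r := by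
  -- The determinant is affine in an extra entry `y` at the root: `y = 0` gives the determinant, and
  -- the increment to `y = 1` gives the root minor.
  have key : ∀ y : ℝ[X], (charM (joinEdge G r H c) + single (Sum.inl r) (Sum.inl r) y).det =
      (charM H + single c c 1).det * ((charM G).det + (1 + y) * (charM G).adjugate r r) -
        (charM H).adjugate c c * (charM G).adjugate r r := by
    intro y
    have h1 : charM (joinEdge G r H c) + single (Sum.inl r) (Sum.inl r) y =
        fromBlocks (charM G + single r r (1 + y))
          (of fun v w => if v = r then (-Pi.single c 1 : W → ℝ[X]) w else 0)
          (of fun w v => if v = r then (-Pi.single c 1 : W → ℝ[X]) w else 0)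
          (charM H + single c c 1) := by
      rw [charM, lapl_joinEdge]
      ext1 (v | w) (v' | w')
      · by_cases h : v = v'
        · subst h
          by_cases h2 : v = r
          · subst h2; simp [charM]; ring
          · simp [charM, Ne.symm h2]
        · have : ¬ (r = v ∧ r = v') := by rintro ⟨rfl, rfl⟩; exact h rfl
          simp [charM, h, this]
      · by_cases h : v = r <;> by_cases h2 : w' = c <;> simp [h, h2]
      · by_cases h : v' = r <;> by_cases h2 : w = c <;> simp [h, h2]
      · by_cases h : w = w'
        · subst h
          by_cases h2 : w = c
          · subst h2; simp [charM]; ring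
          · simp [charM, Ne.symm h2]
        · have : ¬ (c = w ∧ c = w') := by rintro ⟨rfl, rfl⟩; exact h rfl
          simp [charM, h, this]
    have h2 : (-Pi.single c 1 : W → ℝ[X]) ⬝ᵥ (charM H + single c c 1).adjugate *ᵥ
        (-Pi.single c 1 : W → ℝ[X]) = (charM H).adjugate c c := by
      rw [mulVec_neg, neg_dotProduct_neg, mulVec_single_one, single_one_dotProduct]
      exact adjugate_add_single _ _ _
    rw [h1, det_fromBlocks_adjugate _ _ (fst_grow_rootPair_ne_zero H c),
      det_add_single (charM G), adjugate_add_single (charM G), h2]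
  have hdet : (charM (joinEdge G r H c)).det =
      (charM H + single c c 1).det * ((charM G).det + (charM G).adjugate r r) -
        (charM H).adjugate c c * (charM G).adjugate r r := by
    have h0 := key 0
    rwa [single_zero, add_zero, add_zero, one_mul] at h0
  have hadj : (charM (joinEdge G r H c)).adjugate (.inl r) (.inl r) =
      (charM H + single c c 1).det * (charM G).adjugate r r := by
    have h1 := key 1
    rw [det_add_single, hdet] at h1
    linear_combination h1
  refine TrivSqZeroExt.ext ?_ ?_
  · rw [rootPair_fst, RootPair.mul_fst, fst_grow_rootPair, rootPair_fst, hadj]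
  · rw [rootPair_snd, RootPair.mul_snd, fst_grow_rootPair, RootPair.snd_grow, hadj, hdet,
      rootPair_snd, rootPair_snd, rootPair_fst, rootPair_fst, det_add_single]
    ring

end JoinEdge

/-! ### Decomposition of trees into rooted plane trees. -/

section Tree

open Classical in
/-- The number of vertices of degree one other than the root. -/
noncomputable def rootedLeaves {V : Type*} [Fintype V] (G : SimpleGraph V) (r : V) : ℕ :=
  ∑ v, if v ≠ r ∧ deg G v = 1 then 1 else 0

theorem rootedLeaves_iso {V W : Type*} [Fintype V] [Fintype W] {G : SimpleGraph V}
    {H : SimpleGraph W} (f : G ≃g H) (r : V) : rootedLeaves H (f r) = rootedLeaves G r := by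
  classical
  rw [rootedLeaves, ← f.toEquiv.sum_comp]
  refine Finset.sum_congr rfl fun v _ => ?_
  have h1 : f.toEquiv v = f v := rfl
  simp only [h1, deg_iso, f.injective.ne_iff]

open Classical in
theorem rootedLeaves_joinEdge {V W : Type*} [Fintype V] [Fintype W] (G : SimpleGraph V) (r : V)
    (H : SimpleGraph W) (c : W) : rootedLeaves (joinEdge G r H c) (.inl r) =
      (if deg H c = 0 then 1 else 0) + rootedLeaves H c + rootedLeaves G r := by
  rw [rootedLeaves, Fintype.sum_sum_type, add_comm]
  congr 1
  · rw [rootedLeaves, ← Finset.add_sum_erase _ _ (Finset.mem_univ c),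
      ← Finset.add_sum_erase (a := c) _ _ (Finset.mem_univ c), ← add_assoc]
    congr 1
    · simp [deg_joinEdge_inr]
    · refine Finset.sum_congr rfl fun w hw => ?_
      simp [deg_joinEdge_inr, Finset.ne_of_mem_erase hw]
  · refine Finset.sum_congr rfl fun v _ => ?_
    by_cases hv : v = r
    · simp [hv]
    · simp [hv, deg_joinEdge_inl]

theorem rootPair_subsingleton {V : Type*} [Fintype V] [DecidableEq V] [Subsingleton V]
    (G : SimpleGraph V) (r : V) : rootPair G r = 1 := by
  let _ : Unique V := ⟨⟨r⟩, fun a => Subsingleton.elim _ _⟩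
  have h0 : lapl G r r = 0 := by
    have := lapl_sum G r
    simpa [Fintype.sum_unique, Subsingleton.elim (default : V) r] using this
  have h1 : (charM G).det = X := by
    rw [det_unique, Subsingleton.elim (default : V) r]
    simp [charM, h0]
  have h2 : (charM G).adjugate r r = 1 := by
    rw [adjugate_apply, det_unique, Subsingleton.elim (default : V) r]
    simp
  refine TrivSqZeroExt.ext ?_ ?_
  · rw [rootPair_fst, h2]; rfl
  · rw [rootPair_snd, h1, h2, mul_one, sub_self]; rfl

/-- A tree is obtained from two trees by joining them along any given edge. -/
theorem exists_joinEdge_iso {V : Type*} (T : SimpleGraph V) (hT : T.IsTree) {r c : V}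
    (h : T.Adj r c) : ∃ (s t : Set V) (hr : r ∈ s) (hc : c ∈ t) (A : SimpleGraph s)
      (B : SimpleGraph t) (f : joinEdge A ⟨r, hr⟩ B ⟨c, hc⟩ ≃g T),
      A.IsTree ∧ B.IsTree ∧ f (.inl ⟨r, hr⟩) = r := by
  -- Every edge of a tree is a bridge, so without it `r` and `c` lie in different components, which
  -- are the two trees sought.
  let T' := T.deleteEdges {s(r, c)}
  have hacyc : T'.IsAcyclic := hT.isAcyclic.anti (T.deleteEdges_le _)
  have hbr : ¬ T'.Reachable r c := SimpleGraph.isBridge_iff.1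
    ((SimpleGraph.isAcyclic_iff_forall_adj_isBridge.1 hT.isAcyclic) h)
  let s := T'.connectedComponentMk r
  let t := T'.connectedComponentMk c
  have hadj : ∀ {a b : V}, T'.Adj a b ↔ T.Adj a b ∧ s(a, b) ≠ s(r, c) := by
    intro a b
    simp [T', SimpleGraph.deleteEdges_adj]
  have hcover : ∀ v, v ∈ s.supp ∨ v ∈ t.supp := by
    intro v
    obtain ⟨p⟩ := hT.connected.preconnected v r
    have : ∀ (u w : V) (p : T.Walk u w), w ∈ s.supp ∨ w ∈ t.supp → u ∈ s.supp ∨ u ∈ t.supp := by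
      intro u w p
      induction p with
      | nil => exact id
      | cons hab q ih =>
        rename_i a b d
        intro hd
        by_cases he : s(a, b) = s(r, c)
        · rw [Sym2.eq_iff] at he
          obtain ⟨rfl, -⟩ | ⟨rfl, -⟩ := he
          · exact .inl rfl
          · exact .inr rfl
        · have hab' : T'.Adj a b := hadj.2 ⟨hab, he⟩
          have hc := SimpleGraph.ConnectedComponent.connectedComponentMk_eq_of_adj hab'
          refine (ih hd).imp ?_ ?_ <;>
          · intro hb
            rw [SimpleGraph.ConnectedComponent.mem_supp_iff] at hb ⊢
            rw [hc, hb]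
    exact this v r p (.inl rfl)
  have hdisj : ∀ v, v ∈ s.supp → v ∉ t.supp := by
    intro v hs ht
    rw [SimpleGraph.ConnectedComponent.mem_supp_iff] at hs ht
    exact hbr (SimpleGraph.ConnectedComponent.exact (hs.symm.trans ht))
  have hr : r ∈ s.supp := rfl
  have hc : c ∈ t.supp := rfl
  let e : s.supp ⊕ t.supp ≃ V := Equiv.ofBijective (Sum.elim Subtype.val Subtype.val) (by
    constructor
    · rintro (⟨a, ha⟩ | ⟨a, ha⟩) (⟨b, hb⟩ | ⟨b, hb⟩) hab
      · simpa using hab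
      · obtain rfl : a = b := hab
        exact absurd hb (hdisj _ ha)
      · obtain rfl : a = b := hab
        exact absurd ha (hdisj _ hb)
      · simpa using hab
    · intro v
      obtain h | h := hcover v
      · exact ⟨.inl ⟨v, h⟩, rfl⟩
      · exact ⟨.inr ⟨v, h⟩, rfl⟩)
  have hcross : ∀ a ∈ s.supp, ∀ b ∈ t.supp, T.Adj a b ↔ a = r ∧ b = c := by
    intro a ha b hb
    constructor
    · intro hab
      by_cases he : s(a, b) = s(r, c)
      · rw [Sym2.eq_iff] at he
        obtain he | ⟨rfl, rfl⟩ := he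
        · exact he
        · exact absurd hc (hdisj _ ha)
      · have hab' : T'.Adj a b := hadj.2 ⟨hab, he⟩
        have h1 := SimpleGraph.ConnectedComponent.connectedComponentMk_eq_of_adj hab'
        rw [SimpleGraph.ConnectedComponent.mem_supp_iff] at ha
        refine absurd hb (hdisj b ?_)
        rw [SimpleGraph.ConnectedComponent.mem_supp_iff, ← h1, ha]
    · rintro ⟨rfl, rfl⟩
      exact h
  refine ⟨s.supp, t.supp, hr, hc, s.toSimpleGraph, t.toSimpleGraph, ⟨e, ?_⟩,
    hacyc.isTree_connectedComponent s, hacyc.isTree_connectedComponent t, rfl⟩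
  rintro (⟨a, ha⟩ | ⟨a, ha⟩) (⟨b, hb⟩ | ⟨b, hb⟩)
  · change T.Adj a b ↔ T'.Adj a b
    rw [hadj, and_iff_left]
    intro he
    rw [Sym2.eq_iff] at he
    obtain ⟨rfl, rfl⟩ | ⟨rfl, rfl⟩ := he
    · exact hdisj _ hb hc
    · exact hdisj _ ha hc
  · change T.Adj a b ↔ (⟨a, ha⟩ : s.supp) = ⟨r, hr⟩ ∧ (⟨b, hb⟩ : t.supp) = ⟨c, hc⟩
    rw [hcross a ha b hb, Subtype.mk.injEq, Subtype.mk.injEq]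
  · change T.Adj a b ↔ (⟨b, hb⟩ : s.supp) = ⟨r, hr⟩ ∧ (⟨a, ha⟩ : t.supp) = ⟨c, hc⟩
    rw [T.adj_comm, hcross b hb a ha, Subtype.mk.injEq, Subtype.mk.injEq]
  · change T.Adj a b ↔ T'.Adj a b
    rw [hadj, and_iff_left]
    intro he
    rw [Sym2.eq_iff] at he
    obtain ⟨rfl, rfl⟩ | ⟨rfl, rfl⟩ := he
    · exact hdisj _ hr ha
    · exact hdisj _ hr hb

/-- Every finite rooted tree is described by an `RTree`. -/
theorem exists_rtree {V : Type*} [Fintype V] [DecidableEq V] (T : SimpleGraph V) (hT : T.IsTree)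
    (r : V) : ∃ t : RTree, Fintype.card V = t.edges + 1 ∧ rootedLeaves T r = t.leaves ∧
      rootPair T r = t.val := by
  induction hN : Fintype.card V using Nat.strong_induction_on generalizing V with
  | _ N ih =>
  obtain hV | hV := subsingleton_or_nontrivial V
  · refine ⟨.nil, ?_, ?_, rootPair_subsingleton T r⟩
    · rw [← hN, Fintype.card_eq_one_iff.2 ⟨r, fun v => Subsingleton.elim _ _⟩]; rfl
    · exact Finset.sum_eq_zero fun v _ => if_neg fun h => h.1 (Subsingleton.elim _ _)
  · obtain ⟨c, hc⟩ := hT.connected.preconnected.exists_adj_of_nontrivial r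
    obtain ⟨s, t, hr, hc, A, B, f, hA, hB, hf⟩ := exists_joinEdge_iso T hT hc
    classical
    have hcard : Fintype.card s + Fintype.card t = N := by
      rw [← hN, ← Fintype.card_congr f.toEquiv, Fintype.card_sum]
    have hs : 0 < Fintype.card s := Fintype.card_pos_iff.2 ⟨⟨r, hr⟩⟩
    have ht : 0 < Fintype.card t := Fintype.card_pos_iff.2 ⟨⟨c, hc⟩⟩
    obtain ⟨a, ha1, ha2, ha3⟩ := ih _ (by omega) A hA ⟨r, hr⟩ rfl
    obtain ⟨b, hb1, hb2, hb3⟩ := ih _ (by omega) B hB ⟨c, hc⟩ rfl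
    -- The vertex `c` is a leaf of the joined tree exactly when it is isolated in `B`, which matches
    -- the separate clause for a child `nil` in `RTree.leaves`.
    have hdeg : deg B ⟨c, hc⟩ = 0 ↔ b = .nil := by
      constructor
      · intro h0
        have : Subsingleton t := by
          by_contra hne
          rw [not_subsingleton_iff_nontrivial] at hne
          exact absurd (hB.connected.preconnected.degree_pos_of_nontrivial (⟨c, hc⟩ : t))
            (by unfold deg at h0; omega)
        have h1 := Fintype.card_le_one_iff_subsingleton.2 this
        cases b with
        | nil => rfl
        | node x y => simp only [RTree.edges] at hb1; omega
      · rintro rfl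
        have : Subsingleton t := Fintype.card_le_one_iff_subsingleton.1 hb1.le
        unfold deg
        rw [SimpleGraph.degree, Finset.card_eq_zero, Finset.eq_empty_iff_forall_notMem]
        intro x hx
        rw [SimpleGraph.mem_neighborFinset] at hx
        exact hx.ne (Subsingleton.elim _ _)
    refine ⟨.node b a, ?_, ?_, ?_⟩
    · simp only [RTree.edges]; omega
    · rw [← hf, rootedLeaves_iso, rootedLeaves_joinEdge, ha2, hb2, RTree.leaves_node]
      congr 1
      cases b with
      | nil => simp [hdeg, RTree.leaves]
      | node x y => simp [hdeg, RTree.leaves]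
    · rw [← hf, rootPair_iso, rootPair_joinEdge, ha3, hb3]; rfl

theorem rootPair_pathGraph (m : ℕ) : rootPair (SimpleGraph.pathGraph (m + 1)) 0 =
    RootPair.leg m := by
  induction m with
  | zero =>
    have : Subsingleton (Fin (0 + 1)) := inferInstanceAs (Subsingleton (Fin 1))
    exact rootPair_subsingleton _ _
  | succ m ih =>
    let e : Unit ⊕ Fin (m + 1) ≃ Fin (m + 1 + 1) :=
      { toFun := Sum.elim (fun _ => 0) Fin.succ
        invFun := Fin.cases (.inl ()) .inr
        left_inv := by rintro (_ | i) <;> rfl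
        right_inv := by
          intro i
          induction i using Fin.cases <;> rfl }
    have hadj : ∀ j : Fin (m + 1), (SimpleGraph.pathGraph (m + 1 + 1)).Adj 0 j.succ ↔ j = 0 := by
      intro j
      rw [SimpleGraph.pathGraph_adj, Fin.ext_iff, Fin.val_succ, Fin.val_zero, Fin.val_zero]
      omega
    let f : joinEdge (⊥ : SimpleGraph Unit) () (SimpleGraph.pathGraph (m + 1)) 0 ≃g
        SimpleGraph.pathGraph (m + 1 + 1) := ⟨e, by
      rintro (_ | i) (_ | j)
      · exact iff_of_false (SimpleGraph.irrefl _) (SimpleGraph.irrefl _)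
      · exact (hadj j).trans ⟨fun h => ⟨rfl, h⟩, And.right⟩
      · exact ((SimpleGraph.adj_comm _ _ _).trans (hadj i)).trans ⟨fun h => ⟨rfl, h⟩, And.right⟩
      · change (SimpleGraph.pathGraph (m + 1 + 1)).Adj i.succ j.succ ↔
          (SimpleGraph.pathGraph (m + 1)).Adj i j
        rw [SimpleGraph.pathGraph_adj, SimpleGraph.pathGraph_adj, Fin.val_succ, Fin.val_succ]
        omega⟩
    have h : f (.inl ()) = 0 := rfl
    rw [← h, rootPair_iso, rootPair_joinEdge, rootPair_subsingleton (⊥ : SimpleGraph Unit) (),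
      mul_one, ih, RootPair.leg_succ]

end Tree
end LapUnicyclic

/-! ### Trees attached to a cycle. -/

namespace LapUnicyclic
open Polynomial Matrix

section BlockDiagonal

theorem sum_blockDiagonal'_apply {R K : Type*} [AddCommMonoid R] [Fintype K] [DecidableEq K]
    {W : K → Type*} [∀ k, Fintype (W k)] (M : ∀ k, Matrix (W k) (W k) R) (k : K) (x : W k) :
    ∑ q, blockDiagonal' M ⟨k, x⟩ q = ∑ y, M k x y := by
  rw [Fintype.sum_sigma, Finset.sum_eq_single k]
  · simp
  · intro j _ hj
    exact Finset.sum_eq_zero fun y _ => blockDiagonal'_apply_ne _ _ _ (Ne.symm hj)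
  · simp

/-- Both sides give the determinant times the identity when multiplied by the block matrix, and the
nonzero determinant cancels in a domain. -/
theorem adjugate_blockDiagonal' {R : Type*} [CommRing R] [IsDomain R] {K : Type*} [Fintype K]
    [LinearOrder K] {W : K → Type*} [∀ k, Fintype (W k)] [∀ k, DecidableEq (W k)]
    (M : ∀ k, Matrix (W k) (W k) R) (hM : ∀ k, (M k).det ≠ 0) :
    (blockDiagonal' M).adjugate = blockDiagonal' fun k =>
      (∏ j ∈ Finset.univ.erase k, (M j).det) • (M k).adjugate := by
  have hdet : (blockDiagonal' M).det ≠ 0 := by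
    rw [det_blockDiagonal_sigma]
    exact Finset.prod_ne_zero_iff.2 fun k _ => hM k
  have h1 : blockDiagonal' M * (blockDiagonal' fun k =>
      (∏ j ∈ Finset.univ.erase k, (M j).det) • (M k).adjugate) =
      (blockDiagonal' M).det • 1 := by
    rw [← blockDiagonal'_mul, det_blockDiagonal_sigma, ← blockDiagonal'_one,
      ← blockDiagonal'_smul]
    congr 1
    funext k
    rw [Matrix.mul_smul, mul_adjugate, smul_smul, Finset.prod_erase_mul _ _ (Finset.mem_univ k)]
    rfl
  have h2 := congrArg (fun N => (blockDiagonal' M).adjugate * N) h1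
  simp only [← Matrix.mul_assoc, adjugate_mul, smul_mul, Matrix.one_mul, Matrix.mul_smul,
    Matrix.mul_one] at h2
  exact (smul_right_injective _ hdet h2).symm

/-- Rescaling two columns and changing the two corresponding diagonal entries. -/
theorem det_mul_diagonal_add_single {R ι : Type*} [CommRing R] [Fintype ι] [DecidableEq ι]
    (M : Matrix ι ι R) (a : ι → R) {i j : ι} (hij : i ≠ j)
    (ha : ∀ k, k ≠ i → k ≠ j → a k = 1) (x y : R) :
    (M * diagonal a + single i i x + single j j y).det =
      a i * a j * M.det + (x * a j * M.adjugate i i + a i * y * M.adjugate j j) +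
      x * y * (M.submatrix (Subtype.val : {k // k ≠ i ∧ k ≠ j} → ι) Subtype.val).det := by
  have hadj : ∀ k l, k ≠ l → (∀ m, m ≠ k → m ≠ l → a m = 1) →
      (M * diagonal a).adjugate k k = a l * M.adjugate k k := by
    intro k l hkl h
    rw [adjugate_mul_distrib, adjugate_diagonal, diagonal_mul]
    congr 1
    refine Finset.prod_eq_single_of_mem l (by simp [hkl.symm]) fun m hm hml => ?_
    exact h m (Finset.ne_of_mem_erase hm) hml
  have hdet : (M * diagonal a).det = a i * a j * M.det := by
    rw [det_mul, det_diagonal, ← Finset.mul_prod_erase _ _ (Finset.mem_univ i),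
      Finset.prod_eq_single_of_mem j (by simp [hij.symm])
        fun m hm hmj => ha m (Finset.ne_of_mem_erase hm) hmj]
    ring
  have hrow : (M * diagonal a + single i i x).updateRow j (Pi.single j 1) =
      (M * diagonal a).updateRow j (Pi.single j 1) + single i i x := by
    ext k l
    by_cases hk : k = j
    · subst hk
      simp [hij]
    · simp [hk]
  have hminor : ((M * diagonal a).updateRow j (Pi.single j 1)).adjugate i i =
      (M.submatrix (Subtype.val : {k // k ≠ i ∧ k ≠ j} → ι) Subtype.val).det := by
    have h1 : (M * diagonal a).submatrix (Subtype.val : {k // k ≠ i ∧ k ≠ j} → ι)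
        (Subtype.val : {k // k ≠ i ∧ k ≠ j} → ι) =
        M.submatrix (Subtype.val : {k // k ≠ i ∧ k ≠ j} → ι) Subtype.val := by
      ext k l
      simp [ha l l.2.1 l.2.2]
    rw [← h1, ← det_ite_one (M * diagonal a) (fun k => k ≠ i ∧ k ≠ j), adjugate_apply]
    congr 1
    ext k l
    by_cases hki : k = i
    · subst hki; simp [Pi.single_apply, eq_comm]
    · by_cases hkj : k = j
      · subst hkj; simp [hki, Pi.single_apply, eq_comm]
      · simp [hki, hkj]
  have hj : (M * diagonal a + single i i x).adjugate j j = a i * M.adjugate j j +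
      x * (M.submatrix (Subtype.val : {k // k ≠ i ∧ k ≠ j} → ι) Subtype.val).det := by
    rw [adjugate_apply, hrow, det_add_single, ← adjugate_apply, hminor,
      hadj j i hij.symm fun m h1 h2 => ha m h2 h1]
  rw [det_add_single, det_add_single, hdet, hadj i j hij ha, hj]
  ring

end BlockDiagonal

section Attach

variable {g : ℕ} {W : Fin g → Type*} (T : ∀ i, SimpleGraph (W i)) (r : ∀ i, W i)

theorem attachTrees_adj_same (i : Fin g) (x y : W i) :
    (attachTrees T r).Adj ⟨i, x⟩ ⟨i, y⟩ ↔ (T i).Adj x y := by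
  rw [attachTrees, SimpleGraph.sup_adj, SimpleGraph.iSup_adj]
  constructor
  · rintro (⟨hne, a, b, -, ha, hb⟩ | ⟨k, hne, a, b, hab, ha, hb⟩)
    · obtain ⟨rfl, ha⟩ := Sigma.mk.inj_iff.1 ha
      obtain ⟨rfl, hb⟩ := Sigma.mk.inj_iff.1 hb
      exact absurd (by rw [← eq_of_heq ha, ← eq_of_heq hb]) hne
    · obtain ⟨rfl, ha⟩ := Sigma.mk.inj_iff.1 ha
      obtain ⟨-, hb⟩ := Sigma.mk.inj_iff.1 hb
      rwa [← eq_of_heq ha, ← eq_of_heq hb]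
  · intro h
    exact .inr ⟨i, by simpa using h.ne, x, y, h, rfl, rfl⟩

theorem attachTrees_adj_ne {i j : Fin g} (hij : i ≠ j) (x : W i) (y : W j) :
    (attachTrees T r).Adj ⟨i, x⟩ ⟨j, y⟩ ↔
      (x = r i ∧ y = r j) ∧ (SimpleGraph.cycleGraph g).Adj i j := by
  rw [attachTrees, SimpleGraph.sup_adj, SimpleGraph.iSup_adj]
  constructor
  · rintro (⟨hne, a, b, hab, ha, hb⟩ | ⟨k, hne, a, b, hab, ha, hb⟩)
    · obtain ⟨rfl, ha⟩ := Sigma.mk.inj_iff.1 ha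
      obtain ⟨rfl, hb⟩ := Sigma.mk.inj_iff.1 hb
      exact ⟨⟨(eq_of_heq ha).symm, (eq_of_heq hb).symm⟩, hab⟩
    · obtain ⟨rfl, -⟩ := Sigma.mk.inj_iff.1 ha
      obtain ⟨rfl, -⟩ := Sigma.mk.inj_iff.1 hb
      exact absurd rfl hij
  · rintro ⟨⟨rfl, rfl⟩, h⟩
    exact .inl ⟨fun e => hij (Sigma.mk.inj_iff.1 e).1, i, j, h, rfl, rfl⟩

variable [∀ i, Fintype (W i)] [∀ i, DecidableEq (W i)]

theorem lapl_attachTrees : lapl (attachTrees T r) =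
    blockDiagonal' (fun i => lapl (T i)) + of fun p q : Σ i, W i =>
      if p.2 = r p.1 ∧ q.2 = r q.1 then lapl (SimpleGraph.cycleGraph g) p.1 q.1 else 0 := by
  classical
  apply lapl_eq
  · rintro ⟨i, x⟩ ⟨j, y⟩ hne
    by_cases hij : i = j
    · subst hij
      have hxy : x ≠ y := by rintro rfl; exact hne rfl
      have : ¬ (x = r i ∧ y = r i) := by rintro ⟨rfl, rfl⟩; exact hxy rfl
      simp only [Matrix.add_apply, blockDiagonal'_apply_eq, of_apply, this, if_false, add_zero,
        lapl_of_ne _ hxy, attachTrees_adj_same]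
    · simp only [Matrix.add_apply, blockDiagonal'_apply_ne _ _ _ hij, of_apply, zero_add,
        lapl_of_ne _ hij, attachTrees_adj_ne T r hij]
      split_ifs <;> simp_all
  · rintro ⟨i, x⟩
    simp only [Matrix.add_apply, Finset.sum_add_distrib, sum_blockDiagonal'_apply, lapl_sum,
      of_apply, zero_add]
    rw [Fintype.sum_sigma]
    by_cases hx : x = r i
    · simp [hx, lapl_sum]
    · simp [hx]

theorem deg_attachTrees (i : Fin g) (x : W i) : deg (attachTrees T r) ⟨i, x⟩ =
    deg (T i) x + if x = r i then deg (SimpleGraph.cycleGraph g) i else 0 := by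
  have h := congrFun (congrFun (lapl_attachTrees T r) ⟨i, x⟩) ⟨i, x⟩
  rw [lapl_self, Matrix.add_apply, blockDiagonal'_apply_eq, lapl_self, of_apply, lapl_self] at h
  simp only [and_self] at h
  exact_mod_cast h

/-- Contracting each tree leaves its determinant `X a + b` on the diagonal. The part `X a` joins the
Laplacian of the cycle, scaled by `a`, to form the first summand. -/
theorem charM_attachTrees_det : (charM (attachTrees T r)).det =
    (charM (SimpleGraph.cycleGraph g) * diagonal (fun i => (rootPair (T i) (r i)).fst) +
      diagonal fun i => (rootPair (T i) (r i)).snd).det := by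
  have h1 : charM (attachTrees T r) = blockDiagonal' (fun i => charM (T i)) +
      of fun p q : Σ i, W i => if p.2 = r p.1 ∧ q.2 = r q.1 then
        (lapl (SimpleGraph.cycleGraph g)).map Polynomial.C p.1 q.1 else 0 := by
    rw [charM, lapl_attachTrees]
    ext1 ⟨i, x⟩ ⟨j, y⟩
    simp only [Matrix.add_apply, map_apply, of_apply, map_add, apply_ite Polynomial.C, map_zero]
    rw [add_right_comm]
    congr 1
    by_cases hij : i = j
    · subst hij
      by_cases hxy : x = y
      · subst hxy; simp [charM]
      · simp [charM, hxy]
    · have hne : (⟨i, x⟩ : Σ i, W i) ≠ ⟨j, y⟩ := fun e => hij (Sigma.mk.inj_iff.1 e).1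
      rw [blockDiagonal'_apply_ne _ _ _ hij, blockDiagonal'_apply_ne _ _ _ hij,
        diagonal_apply_ne _ hne, map_zero, add_zero]
  rw [h1, det_blockDiagonal_add _ fun i => charM_det_ne_zero (T i)]
  congr 1
  have h2 : ∀ i, (charM (T i)).det = X * (rootPair (T i) (r i)).fst +
      (rootPair (T i) (r i)).snd := fun i => (phi_rootPair (T i) (r i)).symm
  simp only [h2, ← rootPair_fst]
  rw [charM, Matrix.add_mul, diagonal_mul_diagonal, ← diagonal_add]
  abel

end Attach

/-! ### A starlike tree glued to a graph at its center. -/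

section Sun

variable {V W : Type*} [DecidableEq W]

theorem glue_adj_inl_inl (G : SimpleGraph V) (a : V) (H : SimpleGraph W) (b : W) (v v' : V) :
    (glue G a H b).Adj (.inl v) (.inl v') ↔ G.Adj v v' := by
  rw [glue, SimpleGraph.sup_adj]
  constructor
  · rintro (⟨-, x, y, hxy, hx, hy⟩ | ⟨hne, x, y, hxy, hx, hy⟩)
    · rwa [← Sum.inl.inj hx, ← Sum.inl.inj hy]
    · unfold glueMap at hx hy
      split_ifs at hx hy
      exact absurd (hx.symm.trans hy) hne
  · intro h
    exact .inl ⟨by simpa using h.ne, v, v', h, rfl, rfl⟩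

theorem glue_adj_inl_inr (G : SimpleGraph V) (a : V) (H : SimpleGraph W) (b : W) (v : V) (w : W)
    (hw : w ≠ b) : (glue G a H b).Adj (.inl v) (.inr ⟨w, hw⟩) ↔ v = a ∧ H.Adj b w := by
  rw [glue, SimpleGraph.sup_adj]
  constructor
  · rintro (⟨-, x, y, hxy, hx, hy⟩ | ⟨hne, x, y, hxy, hx, hy⟩)
    · cases hy
    · unfold glueMap at hx hy
      split_ifs at hx hy with h1 h2
      cases hx
      cases hy
      exact ⟨rfl, h1 ▸ hxy⟩
  · rintro ⟨rfl, h⟩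
    exact .inr ⟨Sum.inl_ne_inr, b, w, h, by simp [glueMap], by simp [glueMap, hw]⟩

theorem glue_adj_inr_inr (G : SimpleGraph V) (a : V) (H : SimpleGraph W) (b : W) (w w' : W)
    (hw : w ≠ b) (hw' : w' ≠ b) :
    (glue G a H b).Adj (.inr ⟨w, hw⟩) (.inr ⟨w', hw'⟩) ↔ H.Adj w w' := by
  rw [glue, SimpleGraph.sup_adj]
  constructor
  · rintro (⟨-, x, y, hxy, hx, hy⟩ | ⟨hne, x, y, hxy, hx, hy⟩)
    · cases hy
    · unfold glueMap at hx hy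
      split_ifs at hx hy with h1 h2
      cases hx
      cases hy
      exact hxy
  · intro h
    exact .inr ⟨by simpa using h.ne, w, w', h, by simp [glueMap, hw], by simp [glueMap, hw']⟩

theorem starlike_adj_none {l : ℕ} (m : Fin l → ℕ) (i : Fin l) (j : Fin (m i)) :
    (starlike m).Adj none (some ⟨i, j⟩) ↔ j.val = 0 := by
  rw [starlike, SimpleGraph.iSup_adj]
  constructor
  · rintro ⟨k, -, a, b, hab, ha, hb⟩
    cases a using Fin.cases with
    | succ a => cases ha
    | zero =>
      cases b using Fin.cases with
      | zero => cases hb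
      | succ b =>
        have hb' : (⟨k, b⟩ : Σ i, Fin (m i)) = ⟨i, j⟩ := Option.some.inj hb
        obtain ⟨rfl, hb'⟩ := Sigma.mk.inj_iff.1 hb'
        obtain rfl := eq_of_heq hb'
        rw [SimpleGraph.pathGraph_adj] at hab
        simp only [Fin.val_zero, Fin.val_succ] at hab
        omega
  · intro h
    refine ⟨i, by simp, 0, j.succ, ?_, rfl, rfl⟩
    rw [SimpleGraph.pathGraph_adj]
    simp [h]

theorem starlike_adj_same {l : ℕ} (m : Fin l → ℕ) (i : Fin l) (j j' : Fin (m i)) :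
    (starlike m).Adj (some ⟨i, j⟩) (some ⟨i, j'⟩) ↔ (SimpleGraph.pathGraph (m i)).Adj j j' := by
  rw [starlike, SimpleGraph.iSup_adj, SimpleGraph.pathGraph_adj]
  constructor
  · rintro ⟨k, -, a, b, hab, ha, hb⟩
    cases a using Fin.cases with
    | zero => cases ha
    | succ a =>
      cases b using Fin.cases with
      | zero => cases hb
      | succ b =>
        have ha' : (⟨k, a⟩ : Σ i, Fin (m i)) = ⟨i, j⟩ := Option.some.inj ha
        have hb' : (⟨k, b⟩ : Σ i, Fin (m i)) = ⟨i, j'⟩ := Option.some.inj hb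
        obtain ⟨rfl, ha'⟩ := Sigma.mk.inj_iff.1 ha'
        obtain ⟨-, hb'⟩ := Sigma.mk.inj_iff.1 hb'
        obtain rfl := eq_of_heq ha'
        obtain rfl := eq_of_heq hb'
        rw [SimpleGraph.pathGraph_adj] at hab
        simp only [Fin.val_succ] at hab
        omega
  · intro h
    refine ⟨i, ?_, j.succ, j'.succ, ?_, rfl, rfl⟩
    · intro e
      have : j = j' := by simpa using e
      subst this
      omega
    · rw [SimpleGraph.pathGraph_adj]
      simp only [Fin.val_succ]
      omega

theorem starlike_adj_ne {l : ℕ} (m : Fin l → ℕ) {i i' : Fin l} (h : i ≠ i') (j : Fin (m i))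
    (j' : Fin (m i')) : ¬ (starlike m).Adj (some ⟨i, j⟩) (some ⟨i', j'⟩) := by
  rw [starlike, SimpleGraph.iSup_adj]
  rintro ⟨k, -, a, b, hab, ha, hb⟩
  cases a using Fin.cases with
  | zero => cases ha
  | succ a =>
    cases b using Fin.cases with
    | zero => cases hb
    | succ b =>
      cases ha
      cases hb
      exact h rfl

/-- The vertices of a starlike tree other than its center. -/
def legVertexEquiv {l : ℕ} (m : Fin l → ℕ) :
    (Σ i, Fin (m i)) ≃ {w : Option (Σ i, Fin (m i)) // w ≠ none} where
  toFun x := ⟨some x, Option.some_ne_none x⟩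
  invFun w := w.1.get (Option.isSome_iff_ne_none.2 w.2)
  left_inv _ := rfl
  right_inv _ := Subtype.ext (Option.some_get _)

theorem sum_ite_val_eq_zero {R : Type*} [AddCommMonoid R] {n : ℕ} (hn : 0 < n) (f : Fin n → R) :
    ∑ j, (if j.val = 0 then f j else 0) = f ⟨0, hn⟩ := by
  rw [Finset.sum_eq_single ⟨0, hn⟩]
  · simp
  · intro j _ hj
    exact if_neg fun h => hj (Fin.ext h)
  · simp

variable [Fintype V] [DecidableEq V]

theorem lapl_glue_starlike (G : SimpleGraph V) (u : V) {l : ℕ} (m : Fin l → ℕ)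
    (hm : ∀ i, 0 < m i) :
    lapl ((glue G u (starlike m) none).comap
      (Equiv.sumCongr (Equiv.refl V) (legVertexEquiv m))) =
    fromBlocks (lapl G + single u u (l : ℝ))
      (of fun v p => if v = u then (if p.2.val = 0 then -1 else 0) else 0)
      (of fun p v => if v = u then (if p.2.val = 0 then -1 else 0) else 0)
      (blockDiagonal' fun i => lapl (SimpleGraph.pathGraph (m i)) +
        single ⟨0, hm i⟩ ⟨0, hm i⟩ 1) := by
  classical
  apply lapl_eq
  · rintro (v | ⟨i, j⟩) (v' | ⟨i', j'⟩) h
    · have h' : v ≠ v' := fun e => h (congrArg _ e)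
      have h2 : ¬ (u = v ∧ u = v') := by rintro ⟨rfl, rfl⟩; exact h' rfl
      have h3 := glue_adj_inl_inl G u (starlike m) none v v'
      change _ = if (glue G u (starlike m) none).Adj (.inl v) (.inl v') then _ else _
      simp only [h3, fromBlocks_apply₁₁, Matrix.add_apply, lapl_of_ne G h', single_apply, h2,
        if_false, add_zero]
    · have h3 := glue_adj_inl_inr G u (starlike m) none v (some ⟨i', j'⟩) (by simp)
      rw [starlike_adj_none] at h3
      change _ = if (glue G u (starlike m) none).Adj (.inl v) (.inr ⟨some ⟨i', j'⟩, _⟩)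
        then _ else _
      simp only [h3, fromBlocks_apply₁₂, of_apply]
      split_ifs <;> simp_all
    · have h3 := glue_adj_inl_inr G u (starlike m) none v' (some ⟨i, j⟩) (by simp)
      rw [starlike_adj_none, SimpleGraph.adj_comm] at h3
      change _ = if (glue G u (starlike m) none).Adj (.inr ⟨some ⟨i, j⟩, _⟩) (.inl v')
        then _ else _
      simp only [h3, fromBlocks_apply₂₁, of_apply]
      split_ifs <;> simp_all
    · have h3 := glue_adj_inr_inr G u (starlike m) none (some ⟨i, j⟩) (some ⟨i', j'⟩) (by simp)
        (by simp)
      change _ = if (glue G u (starlike m) none).Adj (.inr ⟨some ⟨i, j⟩, _⟩)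
        (.inr ⟨some ⟨i', j'⟩, _⟩) then _ else _
      by_cases hi : i = i'
      · subst hi
        have h' : j ≠ j' := by rintro rfl; exact h rfl
        have h2 : ¬ ((⟨0, hm i⟩ : Fin (m i)) = j ∧ (⟨0, hm i⟩ : Fin (m i)) = j') := by
          rintro ⟨rfl, rfl⟩; exact h' rfl
        rw [starlike_adj_same] at h3
        simp only [h3, fromBlocks_apply₂₂, blockDiagonal'_apply_eq, Matrix.add_apply,
          lapl_of_ne _ h', single_apply, h2, if_false, add_zero]
      · rw [if_neg (h3.not.2 (starlike_adj_ne m hi j j')), fromBlocks_apply₂₂,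
          blockDiagonal'_apply_ne _ _ _ hi]
  · rintro (v | ⟨i, j⟩)
    · rw [Fintype.sum_sum_type, Fintype.sum_sigma]
      by_cases h : v = u
      · subst h
        simp [Finset.sum_add_distrib, lapl_sum, single_apply,
          fun i => sum_ite_val_eq_zero (hm i) fun _ => (-1 : ℝ)]
      · simp [lapl_sum, h, Ne.symm h]
    · rw [Fintype.sum_sum_type]
      simp only [fromBlocks_apply₂₁, fromBlocks_apply₂₂, sum_blockDiagonal'_apply,
        Matrix.add_apply, Finset.sum_add_distrib, lapl_sum, of_apply, Finset.sum_ite_eq',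
        Finset.mem_univ, if_true, zero_add, single_apply]
      by_cases h : j = ⟨0, hm i⟩
      · subst h; simp
      · have h' : j.val ≠ 0 := fun e => h (Fin.ext e)
        simp [h', Ne.symm h]

-- The Leibniz rule for dual numbers.
open RootPair in
theorem snd_prod {ι : Type*} [DecidableEq ι] (s : Finset ι) (x : ι → RootPair) :
    (∏ i ∈ s, x i).snd = ∑ i ∈ s, (x i).snd * ∏ k ∈ s.erase i, (x k).fst := by
  have hfst : ∀ s : Finset ι, (∏ i ∈ s, x i).fst = ∏ i ∈ s, (x i).fst := fun s =>
    map_prod (TrivSqZeroExt.fstHom ℝ ℝ[X] ℝ[X]) x s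
  induction s using Finset.induction with
  | empty => simp
  | insert a s ha ih =>
    rw [Finset.prod_insert ha, mul_snd, ih, hfst, Finset.sum_insert ha, Finset.erase_insert ha,
      Finset.mul_sum, add_comm]
    congr 1
    refine Finset.sum_congr rfl fun i hi => ?_
    have hai : a ≠ i := by rintro rfl; exact ha hi
    rw [Finset.erase_insert_of_ne hai, Finset.prod_insert (by simp [ha])]
    ring

theorem grow_rootPair_pathGraph {m : ℕ} (hm : 0 < m) :
    RootPair.grow (rootPair (SimpleGraph.pathGraph m) ⟨0, hm⟩) = RootPair.leg m := by
  obtain ⟨k, rfl⟩ : ∃ k, m = k + 1 := ⟨m - 1, by omega⟩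
  exact (congrArg RootPair.grow (rootPair_pathGraph k)).trans (RootPair.leg_succ k).symm

/-- The legs meet `u` only through their first vertices, so a Schur complement applies. A leg's
block has determinant `fst` and minor `fst - snd` at its first vertex. -/
theorem charM_glue_starlike_det (G : SimpleGraph V) (u : V) {l : ℕ} (m : Fin l → ℕ)
    (hm : ∀ i, 0 < m i) :
    (charM (glue G u (starlike m) none)).det =
      (∏ i, RootPair.leg (m i)).fst * (charM G).det +
      (∏ i, RootPair.leg (m i)).snd * (charM G).adjugate u u := by
  let e := Equiv.sumCongr (Equiv.refl V) (legVertexEquiv m)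
  let D : ∀ i, Matrix (Fin (m i)) (Fin (m i)) ℝ[X] := fun i =>
    charM (SimpleGraph.pathGraph (m i)) + single ⟨0, hm i⟩ ⟨0, hm i⟩ 1
  let q : (Σ i, Fin (m i)) → ℝ[X] := fun p => if p.2.val = 0 then -1 else 0
  have h1 : charM ((glue G u (starlike m) none).comap e) =
      fromBlocks (charM G + single u u (l : ℝ[X])) (of fun v p => if v = u then q p else 0)
        (of fun p v => if v = u then q p else 0) (blockDiagonal' D) := by
    rw [charM, lapl_glue_starlike G u m hm]
    ext1 (v | ⟨i, j⟩) (v' | ⟨i', j'⟩)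
    · by_cases h : v = v'
      · subst h
        by_cases h2 : v = u
        · subst h2; simp [charM]; ring
        · simp [charM, Ne.symm h2]
      · have : ¬ (u = v ∧ u = v') := by rintro ⟨rfl, rfl⟩; exact h rfl
        simp [charM, h, this]
    · by_cases h : v = u <;> by_cases h2 : j'.val = 0 <;> simp [h, h2, q]
    · by_cases h : v' = u <;> by_cases h2 : j.val = 0 <;> simp [h, h2, q]
    · by_cases hi : i = i'
      · subst hi
        by_cases h : j = j'
        · subst h
          by_cases h2 : j = ⟨0, hm i⟩
          · subst h2; simp [charM, D]; ring
          · simp [charM, D, Ne.symm h2]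
        · have : ¬ ((⟨0, hm i⟩ : Fin (m i)) = j ∧ (⟨0, hm i⟩ : Fin (m i)) = j') := by
            rintro ⟨rfl, rfl⟩; exact h rfl
          simp [charM, D, h, this]
      · have h2 : (⟨i, j⟩ : Σ i, Fin (m i)) ≠ ⟨i', j'⟩ := fun e => hi (Sigma.mk.inj_iff.1 e).1
        simp [blockDiagonal'_apply_ne _ _ _ hi, h2]
  have hfst : ∀ i, (D i).det = (RootPair.leg (m i)).fst := fun i => by
    rw [← grow_rootPair_pathGraph (hm i), fst_grow_rootPair]
  have hsnd : ∀ i, (D i).adjugate ⟨0, hm i⟩ ⟨0, hm i⟩ =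
      (RootPair.leg (m i)).fst - (RootPair.leg (m i)).snd := fun i => by
    rw [← grow_rootPair_pathGraph (hm i), RootPair.fst_grow, RootPair.snd_grow, ← sub_sub]
    rw [adjugate_add_single, rootPair_fst]
    ring
  have hD : ∀ i, (D i).det ≠ 0 := fun i => fst_grow_rootPair_ne_zero _ _
  have hD' : (blockDiagonal' D).det ≠ 0 := by
    rw [det_blockDiagonal_sigma]
    exact Finset.prod_ne_zero_iff.2 fun k _ => hD k
  have hq : q ⬝ᵥ (blockDiagonal' D).adjugate *ᵥ q = ∑ i, (D i).adjugate ⟨0, hm i⟩ ⟨0, hm i⟩ *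
      ∏ k ∈ Finset.univ.erase i, (RootPair.leg (m k)).fst := by
    rw [adjugate_blockDiagonal' D hD]
    simp only [dotProduct, mulVec, Fintype.sum_sigma, q]
    refine Finset.sum_congr rfl fun i _ => ?_
    simp only [ite_mul, zero_mul, mul_ite, mul_zero]
    rw [sum_ite_val_eq_zero (hm i)]
    rw [Finset.sum_eq_single i]
    · rw [sum_ite_val_eq_zero (hm i)]
      simp only [blockDiagonal'_apply_eq, Matrix.smul_apply, smul_eq_mul, hfst]
      ring
    · intro j _ hj
      refine Finset.sum_eq_zero fun y _ => ?_
      rw [blockDiagonal'_apply_ne _ _ _ (Ne.symm hj), zero_mul, ite_self]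
    · simp
  have hA : (∏ i, RootPair.leg (m i)).fst = ∏ i, (RootPair.leg (m i)).fst :=
    map_prod (TrivSqZeroExt.fstHom ℝ ℝ[X] ℝ[X]) _ _
  -- The increase `l` of the degree of `u` is shared out as one per leg. It cancels the `fst` part
  -- of the minors `fst - snd` and leaves the Leibniz sum.
  have hl : (l : ℝ[X]) * ∏ i, (RootPair.leg (m i)).fst = ∑ i, (RootPair.leg (m i)).fst *
      ∏ k ∈ Finset.univ.erase i, (RootPair.leg (m k)).fst := by
    rw [Finset.sum_congr rfl fun i hi =>
      Finset.mul_prod_erase _ (fun k => (RootPair.leg (m k)).fst) hi]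
    simp
  rw [charM_det_iso (SimpleGraph.Iso.comap e (glue G u (starlike m) none)), h1,
    det_fromBlocks_adjugate _ _ hD', hq, det_blockDiagonal_sigma, det_add_single,
    adjugate_add_single, hA, snd_prod]
  simp only [hfst, hsnd, sub_mul, Finset.sum_sub_distrib]
  linear_combination (charM G).adjugate u u * hl

end Sun
end LapUnicyclic

/-! ### Counting leaves, and the final comparison. -/

namespace LapUnicyclic
open Polynomial Matrix

open Classical in
theorem numLeaves_eq {V : Type*} [Fintype V] (G : SimpleGraph V) :
    numLeaves G = ∑ v, if deg G v = 1 then 1 else 0 := by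
  rw [numLeaves, Finset.card_filter]
  rfl

theorem numLeaves_iso {V W : Type*} [Fintype V] [Fintype W] {G : SimpleGraph V}
    {H : SimpleGraph W} (f : G ≃g H) : numLeaves G = numLeaves H := by
  classical
  rw [numLeaves_eq, numLeaves_eq, ← f.toEquiv.sum_comp]
  refine Finset.sum_congr rfl fun v _ => ?_
  have h : f.toEquiv v = f v := rfl
  rw [h, deg_iso]

theorem deg_cycleGraph {g : ℕ} (hg : 3 ≤ g) (i : Fin g) :
    deg (SimpleGraph.cycleGraph g) i = 2 := by
  obtain ⟨n, rfl⟩ := Nat.exists_eq_add_of_le' hg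
  rw [← SimpleGraph.cycleGraph_degree_three_le (v := i), deg]
  congr!

theorem numLeaves_attachTrees {g : ℕ} (hg : 3 ≤ g) {W : Fin g → Type*} [∀ i, Fintype (W i)]
    (T : ∀ i, SimpleGraph (W i)) (r : ∀ i, W i) :
    numLeaves (attachTrees T r) = ∑ i, rootedLeaves (T i) (r i) := by
  classical
  rw [numLeaves_eq, Fintype.sum_sigma]
  refine Finset.sum_congr rfl fun i _ => Finset.sum_congr rfl fun x _ => ?_
  rw [deg_attachTrees, deg_cycleGraph hg]
  by_cases hx : x = r i
  · simp [hx]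
  · simp [hx]

/-- Rotations act transitively on the cycle. This makes the position of an attached tree irrelevant
for the vertex minor. -/
theorem rootPair_cycleGraph {g : ℕ} (i j : Fin g) :
    rootPair (SimpleGraph.cycleGraph g) i = rootPair (SimpleGraph.cycleGraph g) j := by
  cases g with
  | zero => exact i.elim0
  | succ n =>
    let f : SimpleGraph.cycleGraph (n + 1) ≃g SimpleGraph.cycleGraph (n + 1) :=
      ⟨Equiv.addRight (i - j), by
        intro a b
        simp [SimpleGraph.cycleGraph_adj']⟩
    have h : f j = i := by simp [f]
    rw [← h, rootPair_iso]

theorem spider_balanced (e l : ℕ) :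
    ∏ i : Fin l, RootPair.leg ((e + i) / l) = RootPair.spider (RootPair.balanced e l) := by
  rw [← Finset.prod_range fun i => RootPair.leg ((e + i) / l)]
  simp [RootPair.spider, RootPair.balanced, Finset.prod]

theorem card_legVertices {e l : ℕ} (hl : 0 < l) :
    Fintype.card {w : Option (Σ i : Fin l, Fin ((e + i) / l)) // w ≠ none} = e := by
  rw [← Fintype.card_congr (legVertexEquiv _), Fintype.card_sigma]
  simp only [Fintype.card_fin]
  rw [← Finset.sum_range fun i => (e + i) / l]
  exact RootPair.sum_div_eq e hl

/-- Two trees attached at different vertices of a cycle give a larger polynomial than the balanced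
starlike tree attached at one vertex, strictly in some coefficient. -/
theorem charM_compare {g : ℕ} (t t' : RTree) (ht : t ≠ .nil) (ht' : t' ≠ .nil) {i j : Fin g}
    (hij : i ≠ j) (u : Fin g) (p : Fin g → RootPair) (hi : p i = t.val) (hj : p j = t'.val)
    (hp : ∀ k, k ≠ i → k ≠ j → p k = 1) :
    ∃ d : ℝ[X], CoeffNonneg d ∧ d ≠ 0 ∧
      (charM (SimpleGraph.cycleGraph g) * diagonal (fun k => (p k).fst) +
        diagonal fun k => (p k).snd).det =
      (RootPair.spider (RootPair.balanced (t.edges + t'.edges) (t.leaves + t'.leaves))).fst *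
          (charM (SimpleGraph.cycleGraph g)).det +
        (RootPair.spider (RootPair.balanced (t.edges + t'.edges) (t.leaves + t'.leaves))).snd *
          (charM (SimpleGraph.cycleGraph g)).adjugate u u + d := by
  set M := charM (SimpleGraph.cycleGraph g)
  have hdiag : M * diagonal (fun k => (p k).fst) + (diagonal fun k => (p k).snd) =
      M * diagonal (fun k => (p k).fst) + single i i t.val.snd + single j j t'.val.snd := by
    rw [add_assoc]
    congr 1
    ext1 k l
    by_cases hkl : k = l
    · subst hkl
      by_cases hki : k = i
      · subst hki; simp [hi, hij.symm]
      · by_cases hkj : k = j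
        · subst hkj; simp [hj, hij]
        · simp [hp k hki hkj, Ne.symm hki, Ne.symm hkj]
    · have h1 : ¬ (i = k ∧ i = l) := by rintro ⟨rfl, rfl⟩; exact hkl rfl
      have h2 : ¬ (j = k ∧ j = l) := by rintro ⟨rfl, rfl⟩; exact hkl rfl
      simp [hkl, h1, h2]
  have hadj : ∀ k, M.adjugate k k = M.adjugate u u := fun k =>
    congrArg TrivSqZeroExt.fst (rootPair_cycleGraph k u)
  have hs := RTree.compare_spider (t.append t')
  have hdeg : 2 ≤ (t.append t').rootDegree := by
    have h1 := RTree.rootDegree_pos ht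
    have h2 := RTree.rootDegree_pos ht'
    rw [RTree.rootDegree_append]
    omega
  obtain ⟨hphi, hfst⟩ := hs.2 hdeg
  rw [RTree.legs, RTree.edges_append, RTree.leaves_append, RTree.val_append] at hphi hfst
  set S := RootPair.spider (RootPair.balanced (t.edges + t'.edges) (t.leaves + t'.leaves))
  have hC := good_rootPair (SimpleGraph.cycleGraph g) u
  have hC1 : (rootPair (SimpleGraph.cycleGraph g) u).fst = M.adjugate u u := rfl
  have hC2 : (rootPair (SimpleGraph.cycleGraph g) u).snd = M.det - X * M.adjugate u u := rfl
  have hminor := coeffNonneg_minor (SimpleGraph.cycleGraph g) (fun k => k ≠ i ∧ k ≠ j)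
  have hminor0 := minor_ne_zero (SimpleGraph.cycleGraph g) (fun k => k ≠ i ∧ k ≠ j)
  set m := ((charM (SimpleGraph.cycleGraph g)).submatrix
    (Subtype.val : {k // k ≠ i ∧ k ≠ j} → Fin g) Subtype.val).det
  -- With the pair `(m₀, b₀)` of the cycle, `a * det + b * m₀` equals `m₀ * (X a + b) + b₀ * a`, so
  -- domination in `phi` and `fst` is exactly what is needed.
  have h1 := ((hC.1.mul hphi).add (hC.2.mul hfst))
  -- This is the surplus of attaching the trees at two different vertices of the cycle; it is
  -- nonzero.
  have h2 := (((RTree.good_val t).2.mul (RTree.good_val t').2).mul hminor)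
  have h20 : t.val.snd * t'.val.snd * m ≠ 0 :=
    mul_ne_zero (mul_ne_zero (RTree.snd_ne_zero ht) (RTree.snd_ne_zero ht')) hminor0
  refine ⟨_, h1.add h2, ?_, ?_⟩
  · intro h0
    obtain ⟨k, hk⟩ := h2.exists_coeff_pos h20
    have h3 := congrArg (fun q => q.coeff k) h0
    have h4 := h1 k
    simp only [coeff_add, coeff_zero] at h3
    rw [coeff_add] at h4
    linarith
  · rw [hdiag, det_mul_diagonal_add_single M _ hij (fun k h1 h2 => by rw [hp k h1 h2]; rfl),
      hadj i, hadj j, hC1, hC2, hi, hj, RootPair.phi, RootPair.phi, RootPair.mul_fst,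
      RootPair.mul_snd]
    ring

end LapUnicyclic

/-- Every graph `G` in `𝓤_{n,l}^{g,2}` satisfies `U⁰ ≺ G`. -/
theorem theorem3p4 (n l g : ℕ) {V : Type*} [Fintype V] (G : SimpleGraph V)
    (hG : LapUnicyclic.IsInU2 n l g G) (u : Fin g) :
    LapUnicyclic.LapLT (LapUnicyclic.U0 n l g u) G := by
  open LapUnicyclic in
  classical
  obtain ⟨⟨-, hn, hl, hgirth⟩, W, hW, T, r, hT, ⟨i, j, hij, hi, hj, hm⟩, ⟨f⟩⟩ := hG
  have hg : 3 ≤ g := by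
    have h := G.three_le_egirth
    rw [hgirth] at h
    exact_mod_cast h
  choose t ht1 ht2 ht3 using fun k => exists_rtree (T k) (hT k) (r k)
  have hnil : ∀ k, k ≠ i → k ≠ j → t k = .nil := fun k hki hkj => by
    have h := ht1 k
    rw [hm k hki hkj] at h
    cases hk : t k with
    | nil => rfl
    | node c s => rw [hk] at h; simp only [RTree.edges] at h; omega
  have hne : ∀ k, 1 < Fintype.card (W k) → t k ≠ .nil := fun k hk h0 => by
    rw [ht1 k, h0] at hk
    simp [RTree.edges] at hk
  have hcard : n = (t i).edges + (t j).edges + g := by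
    rw [← hn, Fintype.card_congr f.toEquiv, Fintype.card_sigma]
    simp only [ht1, Finset.sum_add_distrib, Finset.sum_const, Finset.card_univ, Fintype.card_fin,
      smul_eq_mul, mul_one]
    rw [Finset.sum_eq_add i j hij (fun k _ hk => by rw [hnil k hk.1 hk.2]; rfl) (by simp)
      (by simp)]
  have hleaves : l = (t i).leaves + (t j).leaves := by
    rw [← hl, numLeaves_iso f, numLeaves_attachTrees hg]
    simp only [ht2]
    rw [Finset.sum_eq_add i j hij (fun k _ hk => by rw [hnil k hk.1 hk.2]; rfl) (by simp)
      (by simp)]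
  have hlpos : 0 < l := by
    have := RTree.leaves_pos (hne i hi)
    omega
  obtain ⟨d, hd, hd0, hdet⟩ := charM_compare (t i) (t j) (hne i hi) (hne j hj) hij u
    (fun k => (t k).val) rfl rfl (fun k h1 h2 => by rw [hnil k h1 h2]; rfl)
  set e := (t i).edges + (t j).edges with he
  -- With at least as many edges as legs no leg of the balanced starlike tree is empty, as the
  -- gluing formula requires.
  have hle : l ≤ e := by
    have h1 := RTree.leaves_le_edges (t i)
    have h2 := RTree.leaves_le_edges (t j)
    omega
  have hsub : ∀ k : Fin l, legLength (n - g + 1) l k = (e + k) / l := fun k => by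
    rw [legLength, hcard, Nat.add_sub_cancel, Nat.add_sub_cancel]
  have hpos : ∀ k : Fin l, 0 < legLength (n - g + 1) l k := fun k => by
    rw [hsub]
    exact Nat.div_pos (by omega) hlpos
  have hU : (charM (U0 n l g u)).det =
      (RootPair.spider (RootPair.balanced e l)).fst * (charM (SimpleGraph.cycleGraph g)).det +
      (RootPair.spider (RootPair.balanced e l)).snd *
        (charM (SimpleGraph.cycleGraph g)).adjugate u u := by
    have h := charM_glue_starlike_det (SimpleGraph.cycleGraph g) u (legLength (n - g + 1) l) hpos
    have h2 : ∏ k, RootPair.leg (legLength (n - g + 1) l k) =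
        RootPair.spider (RootPair.balanced e l) := by
      rw [← spider_balanced]
      simp only [hsub]
    rw [h2] at h
    convert! h
  have hGdet : (charM G).det = (charM (U0 n l g u)).det + d := by
    rw [← charM_det_iso f, charM_attachTrees_det]
    simp only [ht3]
    rw [hdet, hU, ← hleaves]
  have hcardU : Fintype.card (Fin g ⊕ {w : BSTVertex (n - g + 1) l // w ≠ none}) =
      Fintype.card V := by
    have h : Fintype.card {w : BSTVertex (n - g + 1) l // w ≠ none} = e := by
      have h2 := card_legVertices (e := e) hlpos
      rw [← Fintype.card_congr (legVertexEquiv _), Fintype.card_sigma] at h2 ⊢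
      simp only [Fintype.card_fin] at h2 ⊢
      exact (Finset.sum_congr rfl fun k _ => hsub k).trans h2
    rw [Fintype.card_sum, Fintype.card_fin, hn, h]
    omega
  have hcoeff : ∀ k ≤ Fintype.card V, lapCoeff G k = lapCoeff (U0 n l g u) k +
      d.coeff (Fintype.card V - k) := fun k hk => by
    rw [lapCoeff_eq G hk, lapCoeff_eq _ (hcardU ▸ hk), hGdet, Polynomial.coeff_add, hcardU]
  refine ⟨⟨hcardU, fun k hk => ?_⟩, ?_⟩
  · rw [hcoeff k (hcardU ▸ hk)]
    linarith [hd (Fintype.card V - k)]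
  · obtain ⟨k, hk⟩ := hd.exists_coeff_pos hd0
    -- A positive coefficient of `d` beyond the order of the graph would not be a Laplacian
    -- coefficient; both determinants vanish there.
    have hkn : k ≤ Fintype.card V := by
      by_contra hlt
      have h1 := charM_det_coeff_of_lt G (not_le.1 hlt)
      have h2 := charM_det_coeff_of_lt (U0 n l g u) (k := k) (by rw [hcardU]; exact not_le.1 hlt)
      rw [hGdet, Polynomial.coeff_add, h2] at h1
      linarith
    refine ⟨Fintype.card V - k, by rw [hcardU]; omega, ?_⟩
    rw [hcoeff _ (Nat.sub_le _ _), Nat.sub_sub_self hkn]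
    linarith
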